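/- For finite simple graphs $G$ and $J$, a copy of $J$ in $G$ is a (not necessarily induced, unlabeled) subgraph of $G$ isomorphic to $J$, and $N(G,J)$ is the number of copies of $J$ in $G$. Let $G_{n,p}$ be the random graph on $\{1,\dots,n\}$ containing each edge of $K_n$ with probability $p$, independently of other choices. Let $H$ be a finite simple graph with at least one edge and with $v_H:=|V(H)|\le n$. Let $p_c(H)=p_c(n,H)$ be the unique $p\in[0,1]$ for which $\Pr(G_{n,p}\text{ contains a copy of }H)=1/2$, and let $$p_E(H)=p_E(n,H)=\min\{p\in[0,1]:\ \mathbb{E}\,N(G_{n,p},I)\ge 1/2\ \text{ for every subgraph } I\subseteq H\}.$$ Theorem. There is a fixed (absolute) constant $K$ such that for every positive integer $n$ and every graph $H$ as above, if $p_E(H)<1/(3n)$, then $$p_c(H)<K\,p_E(H)\,\log_2 v_H.$$ -/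

import Mathlib

namespace KahnKalai

open MeasureTheory SimpleGraph

/-- The probability that the binomial random graph on `Fin n` with edge probability `p` contains a
copy of `H`, i.e. a (not necessarily induced) subgraph isomorphic to `H`. -/
noncomputable def containProb (n : ℕ) {V : Type*} (H : SimpleGraph V) (p : unitInterval) : ℝ :=
  (binomialRandom (Fin n) p).real {G | H.IsContained G}

/-- The expected number of (unlabelled) copies of `J` in the binomial random graph on `Fin n` with
edge probability `p`. -/
noncomputable def expCopies (n : ℕ) {W : Type*} (J : SimpleGraph W) (p : unitInterval) : ℝ :=
  ∫ G, (G.copyCount J : ℝ) ∂(binomialRandom (Fin n) p)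

/-- The threshold for `H`-containment: the number `p ∈ [0, 1]` at which the random graph contains a
copy of `H` with probability exactly `1 / 2`. If `H` has an edge and at most `n` vertices, then such
a `p` exists and is unique, see `existsUnique_containProb_eq_half` and `pc_spec`. -/
noncomputable def pc (n : ℕ) {V : Type*} (H : SimpleGraph V) : ℝ :=
  sInf {x : ℝ | ∃ p : unitInterval, (p : ℝ) = x ∧ containProb n H p = 1 / 2}

/-- The graphic expectation threshold of `H`: the least `p ∈ [0, 1]` for which every subgraph `I`
of `H` (spanning or not) has at least `1 / 2` expected copies in the random graph. If `H` has at
most `n` vertices, then the minimum is attained, see `isLeast_pE`. -/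
noncomputable def pE (n : ℕ) {V : Type*} (H : SimpleGraph V) : ℝ :=
  sInf {x : ℝ | ∃ p : unitInterval, (p : ℝ) = x ∧ ∀ I : H.Subgraph, 1 / 2 ≤ expCopies n I.coe p}

/-! ### The two thresholds are well defined -/

section WellDefined

lemma binomialRandom_real_singleton (n : ℕ) (p : unitInterval) (G : SimpleGraph (Fin n)) :
    (binomialRandom (Fin n) p).real {G} =
      (p : ℝ) ^ G.edgeSet.ncard * (1 - (p : ℝ)) ^ (n.choose 2 - G.edgeSet.ncard) := by
  simp [measureReal_def]

lemma measurableSet_graph (n : ℕ) (S : Set (SimpleGraph (Fin n))) : MeasurableSet S := by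
  have h1 : ∀ G : SimpleGraph (Fin n), MeasurableSet ({G} : Set (SimpleGraph (Fin n))) := by
    intro G
    have : ({G} : Set (SimpleGraph (Fin n))) = edgeSet ⁻¹' {G.edgeSet} := by
      ext G'; simp
    rw [this]
    exact measurable_edgeSet (measurableSet_singleton _)
  rw [← Set.biUnion_of_singleton S]
  exact S.toFinite.measurableSet_biUnion fun G _ => h1 G

instance (n : ℕ) : MeasurableSingletonClass (SimpleGraph (Fin n)) :=
  ⟨fun _ => measurableSet_graph n _⟩

lemma integral_binomialRandom (n : ℕ) (p : unitInterval) (f : SimpleGraph (Fin n) → ℝ) :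
    ∫ G, f G ∂(binomialRandom (Fin n) p) = ∑ G : SimpleGraph (Fin n),
      (p : ℝ) ^ G.edgeSet.ncard * (1 - (p : ℝ)) ^ (n.choose 2 - G.edgeSet.ncard) * f G := by
  rw [integral_fintype (by exact Integrable.of_finite)]
  simp [binomialRandom_real_singleton]

lemma continuous_expCopies (n : ℕ) {W : Type*} (J : SimpleGraph W) :
    Continuous (expCopies n J) := by
  unfold expCopies
  simp only [integral_binomialRandom]
  fun_prop

lemma isLeast_pE (n : ℕ) {V : Type*} [Fintype V] (H : SimpleGraph V) (hn : Fintype.card V ≤ n) :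
    IsLeast {x : ℝ | ∃ p : unitInterval, (p : ℝ) = x ∧
      ∀ I : H.Subgraph, 1 / 2 ≤ expCopies n I.coe p} (pE n H) := by
  have hcl : IsClosed {p : unitInterval | ∀ I : H.Subgraph, 1 / 2 ≤ expCopies n I.coe p} := by
    simp only [Set.ofPred_forall]
    exact isClosed_iInter fun I => isClosed_le continuous_const (continuous_expCopies n I.coe)
  have hne : {p : unitInterval | ∀ I : H.Subgraph, 1 / 2 ≤ expCopies n I.coe p}.Nonempty := by
    refine ⟨1, fun I => ?_⟩
    have hI : I.coe.IsContained (⊤ : SimpleGraph (Fin n)) := by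
      have f : V ↪ Fin n := (Function.Embedding.nonempty_of_card_le (by simpa using hn)).some
      exact ⟨⟨⟨fun v => f v, fun {a b} h => by simpa using fun h' => h.ne (Subtype.ext h')⟩,
        fun a b h => Subtype.ext (f.injective h)⟩⟩
    have : (1 : ℝ) ≤ ((⊤ : SimpleGraph (Fin n)).copyCount I.coe : ℝ) := by
      exact_mod_cast copyCount_pos.2 hI
    simp only [expCopies, binomialRandom_one, integral_dirac]
    linarith
  obtain ⟨p, hp, hmin⟩ := hcl.isCompact.exists_isLeast hne
  have h : IsLeast {x : ℝ | ∃ p : unitInterval, (p : ℝ) = x ∧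
      ∀ I : H.Subgraph, 1 / 2 ≤ expCopies n I.coe p} (p : ℝ) := by
    refine ⟨⟨p, rfl, hp⟩, ?_⟩
    rintro x ⟨q, rfl, hq⟩
    exact hmin hq
  have he : pE n H = p := h.csInf_eq
  rw [he]
  exact h

/-- Monotonicity in `p` of the probability of an increasing family of subsets of a finite set. -/
lemma sum_upper_mono {α : Type*} [DecidableEq α] (u : Finset α) {p q : ℝ} (hp : 0 ≤ p)
    (hpq : p ≤ q) (hq : q ≤ 1) :
    ∀ f : Finset α → ℝ, Monotone f →
      ∑ S ∈ u.powerset, p ^ S.card * (1 - p) ^ (u.card - S.card) * f S ≤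
        ∑ S ∈ u.powerset, q ^ S.card * (1 - q) ^ (u.card - S.card) * f S := by
  induction u using Finset.induction_on with
  | empty => intro f _; simp
  | insert a s ha ih =>
    intro f hf
    have key : ∀ r : ℝ, ∑ S ∈ (insert a s).powerset,
        r ^ S.card * (1 - r) ^ ((insert a s).card - S.card) * f S =
        (1 - r) * ∑ S ∈ s.powerset, r ^ S.card * (1 - r) ^ (s.card - S.card) * f S +
        r * ∑ S ∈ s.powerset, r ^ S.card * (1 - r) ^ (s.card - S.card) * f (insert a S) := by
      intro r
      rw [Finset.sum_powerset_insert ha, Finset.mul_sum, Finset.mul_sum]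
      congr 1
      · refine Finset.sum_congr rfl fun S hS => ?_
        have hc := Finset.card_le_card (Finset.mem_powerset.1 hS)
        rw [Finset.card_insert_of_notMem ha, Nat.succ_sub hc, pow_succ]
        ring
      · refine Finset.sum_congr rfl fun S hS => ?_
        have haS : a ∉ S := fun h => ha (Finset.mem_powerset.1 hS h)
        rw [Finset.card_insert_of_notMem ha, Finset.card_insert_of_notMem haS,
          Nat.add_sub_add_right, pow_succ]
        ring
    rw [key, key]
    have h1 := ih f hf
    have h2 := ih (fun S => f (insert a S))
      (fun S T h => hf (Finset.insert_subset_insert a h))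
    have h3 : ∑ S ∈ s.powerset, q ^ S.card * (1 - q) ^ (s.card - S.card) * f S ≤
        ∑ S ∈ s.powerset, q ^ S.card * (1 - q) ^ (s.card - S.card) * f (insert a S) := by
      refine Finset.sum_le_sum fun S _ => mul_le_mul_of_nonneg_left (hf (Finset.subset_insert a S)) ?_
      have : 0 ≤ q := hp.trans hpq
      have : 0 ≤ 1 - q := by linarith
      positivity
    nlinarith [mul_le_mul_of_nonneg_left h1 (by linarith : 0 ≤ 1 - p),
      mul_le_mul_of_nonneg_left h2 hp, mul_le_mul_of_nonneg_left h3 (by linarith : 0 ≤ q - p)]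

open Classical in
lemma containProb_eq (n : ℕ) {V : Type*} (H : SimpleGraph V) (p : unitInterval) :
    containProb n H p = ∑ G : SimpleGraph (Fin n),
      (p : ℝ) ^ G.edgeSet.ncard * (1 - (p : ℝ)) ^ (n.choose 2 - G.edgeSet.ncard) *
        if H.IsContained G then 1 else 0 := by
  rw [← integral_binomialRandom n p (fun G => if H.IsContained G then 1 else 0), containProb,
    ← integral_indicator_one (measurableSet_graph n _)]
  rfl

open Classical in
lemma containProb_eq' (n : ℕ) {V : Type*} (H : SimpleGraph V) (p : unitInterval) :
    containProb n H p = ∑ S ∈ (⊤ : SimpleGraph (Fin n)).edgeFinset.powerset,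
      (p : ℝ) ^ S.card *
        (1 - (p : ℝ)) ^ ((⊤ : SimpleGraph (Fin n)).edgeFinset.card - S.card) *
        if H.IsContained (fromEdgeSet (S : Set (Sym2 (Fin n)))) then 1 else 0 := by
  rw [containProb_eq]
  refine Finset.sum_bij' (fun G _ => G.edgeFinset)
    (fun S _ => fromEdgeSet (S : Set (Sym2 (Fin n)))) ?_ ?_ ?_ ?_ ?_
  · intro G _
    exact Finset.mem_powerset.2 (edgeFinset_mono le_top)
  · simp
  · intro G _
    simp
  · intro S hS
    have hS' := Finset.mem_powerset.1 hS
    ext e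
    simp only [mem_edgeFinset, edgeSet_fromEdgeSet, Set.mem_sdiff, Finset.mem_coe]
    refine ⟨fun h => h.1, fun h => ⟨h, ?_⟩⟩
    have := hS' h
    simpa using this
  · intro G _
    have h1 : G.edgeSet.ncard = G.edgeFinset.card := by
      rw [← coe_edgeFinset, Set.ncard_coe_finset]
    rw [h1, card_edgeFinset_top_eq_card_choose_two]
    simp

lemma monotone_containProb (n : ℕ) {V : Type*} (H : SimpleGraph V) :
    Monotone (containProb n H) := by
  classical
  intro p q hpq
  rw [containProb_eq', containProb_eq']
  refine sum_upper_mono _ p.2.1 hpq q.2.2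
    (fun S : Finset (Sym2 (Fin n)) =>
      if H.IsContained (fromEdgeSet (S : Set (Sym2 (Fin n)))) then 1 else 0) ?_
  intro S T hST
  have hle : fromEdgeSet (S : Set (Sym2 (Fin n))) ≤ fromEdgeSet (T : Set (Sym2 (Fin n))) :=
    fromEdgeSet_mono (by exact_mod_cast hST)
  by_cases h : H.IsContained (fromEdgeSet (S : Set (Sym2 (Fin n))))
  · simp [h, h.mono_right hle]
  · simp only [h, if_false]
    split_ifs <;> norm_num

lemma existsUnique_containProb_eq_half (n : ℕ) {V : Type*} [Fintype V] (H : SimpleGraph V)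
    (hn : Fintype.card V ≤ n) (hH : H ≠ ⊥) :
    ∃! p : unitInterval, containProb n H p = 1 / 2 := by
  classical
  let P : Polynomial ℝ := ∑ G : SimpleGraph (Fin n),
    Polynomial.X ^ G.edgeSet.ncard * (1 - Polynomial.X) ^ (n.choose 2 - G.edgeSet.ncard) *
      Polynomial.C (if H.IsContained G then 1 else 0)
  have hP : ∀ p : unitInterval, containProb n H p = P.eval (p : ℝ) := by
    intro p
    rw [containProb_eq]
    simp only [P, Polynomial.eval_finsetSum, Polynomial.eval_mul, Polynomial.eval_pow,
      Polynomial.eval_X, Polynomial.eval_sub, Polynomial.eval_one, Polynomial.eval_C]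
  have hcont : Continuous (containProb n H) := by
    have : containProb n H = fun p : unitInterval => P.eval (p : ℝ) := funext hP
    rw [this]
    exact P.continuous.comp continuous_subtype_val
  have h0 : containProb n H 0 = 0 := by
    have : ¬ H.IsContained (⊥ : SimpleGraph (Fin n)) := by
      rintro ⟨f⟩
      obtain ⟨a, b, hab⟩ := SimpleGraph.ne_bot_iff_exists_adj.1 hH
      exact f.toHom.map_adj hab
    simp [containProb, measureReal_def, Measure.dirac_apply' _ (measurableSet_graph n _), this]
  have h1 : containProb n H 1 = 1 := by
    have : H.IsContained (⊤ : SimpleGraph (Fin n)) := by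
      have f : V ↪ Fin n := (Function.Embedding.nonempty_of_card_le (by simpa using hn)).some
      exact ⟨⟨⟨fun v => f v, fun {a b} h => by simpa using h.ne⟩, f.injective⟩⟩
    simp [containProb, measureReal_def, Measure.dirac_apply' _ (measurableSet_graph n _), this]
  have hmem : (1 / 2 : ℝ) ∈ Set.Icc (containProb n H 0) (containProb n H 1) := by
    rw [h0, h1]; constructor <;> norm_num
  obtain ⟨p, hp⟩ := intermediate_value_univ 0 1 hcont hmem
  have hlt : ∀ a b : unitInterval, containProb n H a = 1 / 2 → containProb n H b = 1 / 2 →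
      ¬ a < b := by
    intro a b ha hb hab
    have hroots : Set.Infinite {x : ℝ | (P - Polynomial.C (1 / 2)).IsRoot x} := by
      refine (Set.Icc_infinite (show (a : ℝ) < b from hab)).mono fun x hx => ?_
      let c : unitInterval := ⟨x, a.2.1.trans hx.1, hx.2.trans b.2.2⟩
      have e1 : containProb n H a ≤ containProb n H c := monotone_containProb n H hx.1
      have e2 : containProb n H c ≤ containProb n H b := monotone_containProb n H hx.2
      have e3 : containProb n H c = P.eval x := hP c
      simp only [Set.mem_ofPred_eq, Polynomial.IsRoot, Polynomial.eval_sub, Polynomial.eval_C]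
      linarith
    have hz := Polynomial.eq_zero_of_infinite_isRoot _ hroots
    have := congrArg (Polynomial.eval (((0 : unitInterval) : ℝ))) hz
    rw [Polynomial.eval_sub, ← hP, h0] at this
    norm_num at this
  refine ⟨p, hp, fun q hq => ?_⟩
  exact le_antisymm (not_lt.1 (hlt p q hp hq)) (not_lt.1 (hlt q p hq hp))

/-- `pc n H` lies in `[0, 1]`, and it is the only point there at which the containment probability
is `1 / 2`. -/
lemma pc_spec (n : ℕ) {V : Type*} [Fintype V] (H : SimpleGraph V)
    (hn : Fintype.card V ≤ n) (hH : H ≠ ⊥) (p : unitInterval) :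
    containProb n H p = 1 / 2 ↔ (p : ℝ) = pc n H := by
  obtain ⟨q, hq, huniq⟩ := existsUnique_containProb_eq_half n H hn hH
  have hset : {x : ℝ | ∃ p : unitInterval, (p : ℝ) = x ∧ containProb n H p = 1 / 2} = {(q : ℝ)} := by
    ext x
    constructor
    · rintro ⟨r, rfl, hr⟩
      rw [huniq r hr]
      rfl
    · rintro rfl
      exact ⟨q, rfl, hq⟩
  have hpc : pc n H = q := by rw [pc, hset, csInf_singleton]
  rw [hpc]
  refine ⟨fun h => by rw [huniq p h], fun h => ?_⟩
  rw [Subtype.ext h]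
  exact hq

end WellDefined

end KahnKalai

/-!
Let `p` be the expectation threshold of `H` and let `x = n * p ≤ c < 1 / e`.

Since `x < 1 / 2`, a cycle has fewer than `1 / 2` expected copies, so `H` is a forest. If `m`
components of `H` are isomorphic to a tree `D` of order `s`, then their union has at least
`m! * |Aut D| ^ m` automorphisms; as it has at least `1 / 2` expected copies, `m * |Aut D|` is at
most `2 * e * n * x ^ (s - 1)`. A tree `T` of order `t` is contained in at most `(t + r) ^ r` trees
on `t + r` given vertices, so the components of `H` of order `t + r` contain
`O(n * x ^ (t + r - 1) * e ^ (t + r))` labelled copies of `T`. Summing this over `r`, where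
`e * x < 1` is needed, gives at most `n * (C * x) ^ (t - 1)` labelled copies of `T` in `H`, and
therefore at most `n ^ a * (C * p) ^ b` labelled copies of any graph with `a` vertices and `b`
edges.

Consequently a uniformly random copy of `H` in the complete graph contains a given set of `b` edges
with probability at most `(C' * p) ^ b`. By Park and Pham's argument with minimum fragments, the
union of `O(log v_H)` random graphs of density `64 * C' * p` contains one of these copies with
probability at least `2 / 3`: each graph halves the size of what remains to be covered.
-/

namespace KahnKalai

open Finset MeasureTheory SimpleGraph

section BernoulliExpect

variable {α : Type*}

/-- The probability that a random subset of `u`, containing each element independently with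
probability `q`, equals `S`; meaningful for `S ⊆ u` only. -/
noncomputable def bernoulliWeight (u : Finset α) (q : ℝ) (S : Finset α) : ℝ :=
  q ^ #S * (1 - q) ^ (#u - #S)

/-- The expectation of `f S` for a random subset `S` of `u` containing each element independently
with probability `q`. -/
noncomputable def bernoulliExpect (u : Finset α) (q : ℝ) (f : Finset α → ℝ) : ℝ :=
  ∑ S ∈ u.powerset, bernoulliWeight u q S * f S

lemma bernoulliWeight_nonneg {q : ℝ} (hq₀ : 0 ≤ q) (hq₁ : q ≤ 1) (u S : Finset α) :
    0 ≤ bernoulliWeight u q S :=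
  mul_nonneg (pow_nonneg hq₀ _) (pow_nonneg (sub_nonneg.2 hq₁) _)

lemma bernoulliWeight_insert_of_subset [DecidableEq α] {a : α} {u S : Finset α} (ha : a ∉ u)
    (hS : S ⊆ u) (q : ℝ) :
    bernoulliWeight (insert a u) q S = (1 - q) * bernoulliWeight u q S := by
  rw [bernoulliWeight, bernoulliWeight, card_insert_of_notMem ha,
    Nat.succ_sub (card_le_card hS), pow_succ]
  ring

lemma bernoulliWeight_insert_insert [DecidableEq α] {a : α} {u S : Finset α} (ha : a ∉ u)
    (hS : S ⊆ u) (q : ℝ) :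
    bernoulliWeight (insert a u) q (insert a S) = q * bernoulliWeight u q S := by
  rw [bernoulliWeight, bernoulliWeight, card_insert_of_notMem ha,
    card_insert_of_notMem fun h => ha (hS h), Nat.add_sub_add_right, pow_succ]
  ring

lemma bernoulliExpect_empty (q : ℝ) (f : Finset α → ℝ) : bernoulliExpect ∅ q f = f ∅ := by
  simp [bernoulliExpect, bernoulliWeight]

lemma bernoulliExpect_insert [DecidableEq α] {a : α} {u : Finset α} (ha : a ∉ u) (q : ℝ)
    (f : Finset α → ℝ) :
    bernoulliExpect (insert a u) q f =
      (1 - q) * bernoulliExpect u q f + q * bernoulliExpect u q (fun S => f (insert a S)) := by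
  simp only [bernoulliExpect, sum_powerset_insert ha, mul_sum, ← mul_assoc]
  congr 1 <;> refine sum_congr rfl fun S hS => ?_
  · rw [bernoulliWeight_insert_of_subset ha (mem_powerset.1 hS)]
  · rw [bernoulliWeight_insert_insert ha (mem_powerset.1 hS)]

lemma bernoulliExpect_add (u : Finset α) (q : ℝ) (f g : Finset α → ℝ) :
    bernoulliExpect u q (fun S => f S + g S) = bernoulliExpect u q f + bernoulliExpect u q g := by
  simp only [bernoulliExpect, mul_add, sum_add_distrib]

lemma bernoulliExpect_const_mul (u : Finset α) (q c : ℝ) (f : Finset α → ℝ) :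
    bernoulliExpect u q (fun S => c * f S) = c * bernoulliExpect u q f := by
  simp only [bernoulliExpect, mul_sum, mul_left_comm]

lemma bernoulliExpect_mono {u : Finset α} {q : ℝ} (hq₀ : 0 ≤ q) (hq₁ : q ≤ 1)
    {f g : Finset α → ℝ} (h : ∀ S ⊆ u, f S ≤ g S) :
    bernoulliExpect u q f ≤ bernoulliExpect u q g :=
  sum_le_sum fun S hS =>
    mul_le_mul_of_nonneg_left (h S (mem_powerset.1 hS)) (bernoulliWeight_nonneg hq₀ hq₁ u S)

lemma bernoulliExpect_const (u : Finset α) (q c : ℝ) : bernoulliExpect u q (fun _ => c) = c := by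
  classical
  induction u using Finset.induction_on with
  | empty => exact bernoulliExpect_empty q _
  | insert a u ha ih => rw [bernoulliExpect_insert ha, ih]; ring

lemma bernoulliExpect_union [DecidableEq α] (u : Finset α) (q r : ℝ) (f : Finset α → ℝ) :
    bernoulliExpect u q (fun S => bernoulliExpect u r fun T => f (S ∪ T)) =
      bernoulliExpect u (1 - (1 - q) * (1 - r)) f := by
  induction u using Finset.induction_on generalizing f with
  | empty => simp only [bernoulliExpect_empty, union_empty]
  | insert a u ha ih =>
    simp only [bernoulliExpect_insert ha, bernoulliExpect_add, bernoulliExpect_const_mul,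
      insert_union, union_insert, insert_idem]
    rw [ih, ih fun S => f (insert a S)]
    ring

lemma bernoulliExpect_superset [DecidableEq α] {u A : Finset α} (hA : A ⊆ u) (q : ℝ) :
    bernoulliExpect u q (fun S => if A ⊆ S then 1 else 0) = q ^ #A := by
  induction u using Finset.induction_on generalizing A with
  | empty => simp [bernoulliExpect_empty, subset_empty.1 hA]
  | insert a u ha ih =>
    rw [bernoulliExpect_insert ha]
    by_cases haA : a ∈ A
    · have hzero : bernoulliExpect u q (fun S => if A ⊆ S then 1 else 0) = 0 :=
        sum_eq_zero fun S hS => mul_eq_zero_of_right _ <|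
          if_neg fun h => ha (mem_powerset.1 hS (h haA))
      simp only [hzero, subset_insert_iff (s := A)]
      rw [ih (subset_insert_iff.1 hA), ← card_erase_add_one haA, pow_succ]
      ring
    · simp only [subset_insert_iff_of_notMem haA]
      rw [ih ((subset_insert_iff_of_notMem haA).1 hA)]
      ring

end BernoulliExpect

section Spread

variable {α ι : Type*} [DecidableEq α]

/-- `T` is a minimum fragment, in the sense of Park and Pham, of the family `A` over the random
set `W`: a set disjoint from `W` such that `W ∪ T` contains a member of the family and `T` is
contained in every such member. -/
def IsFragment (Ω : Finset ι) (A : ι → Finset α) (W T : Finset α) : Prop :=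
  Disjoint W T ∧ (∃ v ∈ Ω, A v ⊆ W ∪ T) ∧ ∀ v ∈ Ω, A v ⊆ W ∪ T → T ⊆ A v

open Classical in
/-- The fragments of size more than `l / 2` of a family of subsets of `u`. -/
noncomputable def largeFragments (Ω : Finset ι) (A : ι → Finset α) (u : Finset α) (l : ℕ)
    (W : Finset α) : Finset (Finset α) :=
  {T ∈ u.powerset | l < 2 * #T ∧ IsFragment Ω A W T}

/-- The spread condition on the family `A`: at most a proportion `p ^ #R` of `N` members contains
a given set `R`. The normalization `N` is not tied to `#Ω`, so that the condition passes to
subfamilies. -/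
def IsSpread (Ω : Finset ι) (A : ι → Finset α) (N p : ℝ) : Prop :=
  ∀ R : Finset α, R.Nonempty → (#{w ∈ Ω | R ⊆ A w} : ℝ) ≤ N * p ^ #R

open Classical in
/-- The probability that the random subset of `u` of density `q` contains no member of the
family `A`. -/
noncomputable def missProb (u : Finset α) (q : ℝ) (Ω : Finset ι) (A : ι → Finset α) : ℝ :=
  bernoulliExpect u q fun W => if ∃ w ∈ Ω, A w ⊆ W then 0 else 1

variable {u : Finset α} {Ω : Finset ι} {A : ι → Finset α} {p N : ℝ} {l : ℕ}

lemma mem_largeFragments {W T : Finset α} :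
    T ∈ largeFragments Ω A u l W ↔ T ⊆ u ∧ l < 2 * #T ∧ IsFragment Ω A W T := by
  classical rw [largeFragments, mem_filter, mem_powerset]

lemma IsSpread.mono (h : IsSpread Ω A N p) {Ω' : Finset ι} (hΩ : Ω' ⊆ Ω) {B : ι → Finset α}
    (hB : ∀ w ∈ Ω', B w ⊆ A w) : IsSpread Ω' B N p := by
  refine fun R hR => le_trans (Nat.cast_le.2 (card_le_card fun w hw => ?_)) (h R hR)
  obtain ⟨hw, hRw⟩ := mem_filter.1 hw
  exact mem_filter.2 ⟨hΩ hw, hRw.trans (hB w hw)⟩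

lemma exists_subset_isFragment (A : ι → Finset α) (W : Finset α) {w : ι} (hw : w ∈ Ω) :
    ∃ T ⊆ A w, IsFragment Ω A W T := by
  obtain ⟨v, hv, hmin⟩ := exists_min_image {v ∈ Ω | A v ⊆ W ∪ A w} (fun v => #(A v \ W))
    ⟨w, mem_filter.2 ⟨hw, subset_union_right⟩⟩
  obtain ⟨hvΩ, hvw⟩ := mem_filter.1 hv
  have hT : A v \ W ⊆ A w := sdiff_le_iff.2 hvw
  refine ⟨A v \ W, hT, disjoint_sdiff, ⟨v, hvΩ, ?_⟩, fun v' hv' hsub => ?_⟩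
  · rw [union_sdiff_self_eq_union]
    exact subset_union_right
  · have hle := hmin v' (mem_filter.2 ⟨hv', hsub.trans (union_subset_union_right hT)⟩)
    rw [← eq_of_subset_of_card_le (sdiff_le_iff.2 hsub) hle]
    exact sdiff_subset

lemma bernoulliWeight_mul_pow_le {q r : ℝ} (hq₀ : 0 ≤ q) (hq₁ : q ≤ 1) (hr : 0 ≤ r)
    {W T : Finset α} (hWT : Disjoint W T) (hu : W ∪ T ⊆ u) :
    bernoulliWeight u q W * (q * r) ^ #T ≤ bernoulliWeight u q (W ∪ T) * r ^ #T := by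
  have hcard : #(W ∪ T) = #W + #T := card_union_of_disjoint hWT
  have hle : #W + #T ≤ #u := hcard ▸ card_le_card hu
  have hpow : (1 - q) ^ (#u - #W) ≤ (1 - q) ^ (#u - (#W + #T)) :=
    pow_le_pow_of_le_one (sub_nonneg.2 hq₁) (by linarith) (by omega)
  calc bernoulliWeight u q W * (q * r) ^ #T
      = q ^ (#W + #T) * r ^ #T * (1 - q) ^ (#u - #W) := by
        rw [bernoulliWeight, pow_add, mul_pow]; ring
    _ ≤ q ^ (#W + #T) * r ^ #T * (1 - q) ^ (#u - (#W + #T)) :=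
        mul_le_mul_of_nonneg_left hpow (by positivity)
    _ = bernoulliWeight u q (W ∪ T) * r ^ #T := by rw [bernoulliWeight, hcard]; ring

open Classical in
/-- Park and Pham's double counting: a pair `(W, T)` is encoded by `(W ∪ T, T)`. -/
lemma sum_largeFragments_eq_sum_union (f : Finset α → Finset α → ℝ) :
    ∑ W ∈ u.powerset, ∑ T ∈ largeFragments Ω A u l W, f (W ∪ T) T =
      ∑ Z ∈ u.powerset, ∑ T ∈ Z.powerset with T ∈ largeFragments Ω A u l (Z \ T), f Z T := by
  have hdisj {W T : Finset α} (h : T ∈ largeFragments Ω A u l W) : (W ∪ T) \ T = W := by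
    rw [union_sdiff_right, sdiff_eq_self_of_disjoint (mem_largeFragments.1 h).2.2.1]
  rw [sum_sigma', sum_sigma']
  refine sum_bij' (fun x _ => ⟨x.1 ∪ x.2, x.2⟩) (fun x _ => ⟨x.1 \ x.2, x.2⟩) ?_ ?_ ?_ ?_ ?_
  · rintro ⟨W, T⟩ h
    obtain ⟨hW, hT⟩ := mem_sigma.1 h
    refine mem_sigma.2 ⟨mem_powerset.2 (union_subset (mem_powerset.1 hW)
      (mem_largeFragments.1 hT).1), mem_filter.2 ⟨?_, ?_⟩⟩
    · exact mem_powerset.2 subset_union_right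
    · rwa [hdisj hT]
  · rintro ⟨Z, T⟩ h
    obtain ⟨hZ, hT⟩ := mem_sigma.1 h
    exact mem_sigma.2
      ⟨mem_powerset.2 (sdiff_subset.trans (mem_powerset.1 hZ)), (mem_filter.1 hT).2⟩
  · rintro ⟨W, T⟩ h
    simp only [hdisj (mem_sigma.1 h).2]
  · rintro ⟨Z, T⟩ h
    simp only [sdiff_union_of_subset (mem_powerset.1 (mem_filter.1 (mem_sigma.1 h).2).1)]
  · exact fun _ _ => rfl

open Classical in
lemma sum_pow_card_largeFragments_sdiff_le (hA : ∀ w ∈ Ω, #(A w) ≤ l) (Z : Finset α) :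
    ∑ T ∈ Z.powerset with T ∈ largeFragments Ω A u l (Z \ T), (1 / 64 : ℝ) ^ #T ≤
      (1 / 4) ^ l := by
  set K := Z.powerset.filter fun T => T ∈ largeFragments Ω A u l (Z \ T)
  have hmem : ∀ T ∈ K, l < 2 * #T ∧ (∃ v ∈ Ω, A v ⊆ Z) ∧ ∀ v ∈ Ω, A v ⊆ Z → T ⊆ A v := by
    intro T hT
    obtain ⟨hTZ, hT⟩ := mem_filter.1 hT
    obtain ⟨-, hl, -, h⟩ := mem_largeFragments.1 hT
    rw [sdiff_union_of_subset (mem_powerset.1 hTZ)] at h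
    exact ⟨hl, h⟩
  rcases K.eq_empty_or_nonempty with hempty | ⟨T₀, hT₀⟩
  · rw [hempty, sum_empty]; positivity
  obtain ⟨v, hv, hvZ⟩ := (hmem T₀ hT₀).2.1
  have hcard : #K ≤ 2 ^ l := calc
    #K ≤ #(A v).powerset :=
      card_le_card fun T hT => mem_powerset.2 ((hmem T hT).2.2 v hv hvZ)
    _ = 2 ^ #(A v) := card_powerset _
    _ ≤ 2 ^ l := Nat.pow_le_pow_right two_pos (hA v hv)
  calc ∑ T ∈ K, (1 / 64 : ℝ) ^ #T ≤ ∑ _T ∈ K, (1 / 8 : ℝ) ^ l := by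
        refine sum_le_sum fun T hT => ?_
        rw [show (1 / 64 : ℝ) = (1 / 8) ^ 2 by norm_num, ← pow_mul]
        exact pow_le_pow_of_le_one (by norm_num) (by norm_num) (hmem T hT).1.le
    _ = #K * (1 / 8 : ℝ) ^ l := by rw [sum_const, nsmul_eq_mul]
    _ ≤ 2 ^ l * (1 / 8) ^ l := by gcongr; exact_mod_cast hcard
    _ = (1 / 4) ^ l := by rw [← mul_pow]; norm_num

lemma bernoulliExpect_largeFragments_le (hA : ∀ w ∈ Ω, #(A w) ≤ l) (hp₀ : 0 ≤ p)
    (hp₁ : 64 * p ≤ 1) :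
    bernoulliExpect u (64 * p) (fun W => ∑ T ∈ largeFragments Ω A u l W, p ^ #T) ≤
      (1 / 4) ^ l := by
  classical
  have hp : p = 64 * p * (1 / 64) := by ring
  calc bernoulliExpect u (64 * p) (fun W => ∑ T ∈ largeFragments Ω A u l W, p ^ #T)
      = ∑ W ∈ u.powerset, ∑ T ∈ largeFragments Ω A u l W,
          bernoulliWeight u (64 * p) W * (64 * p * (1 / 64)) ^ #T := by
        simp only [bernoulliExpect, mul_sum, ← hp]
    _ ≤ ∑ W ∈ u.powerset, ∑ T ∈ largeFragments Ω A u l W,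
          bernoulliWeight u (64 * p) (W ∪ T) * (1 / 64) ^ #T := by
        refine sum_le_sum fun W hW => sum_le_sum fun T hT => ?_
        obtain ⟨hT, -, hWT, -⟩ := mem_largeFragments.1 hT
        exact bernoulliWeight_mul_pow_le (by positivity) hp₁ (by norm_num) hWT
          (union_subset (mem_powerset.1 hW) hT)
    _ = bernoulliExpect u (64 * p) fun Z =>
          ∑ T ∈ Z.powerset with T ∈ largeFragments Ω A u l (Z \ T), (1 / 64) ^ #T := by
        rw [sum_largeFragments_eq_sum_union fun Z T =>
          bernoulliWeight u (64 * p) Z * (1 / 64) ^ #T]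
        simp only [bernoulliExpect, mul_sum]
    _ ≤ bernoulliExpect u (64 * p) fun _ => (1 / 4) ^ l :=
        bernoulliExpect_mono (by positivity) hp₁ fun Z _ =>
          sum_pow_card_largeFragments_sdiff_le hA Z
    _ = (1 / 4) ^ l := bernoulliExpect_const u _ _

lemma card_filter_large_isFragment_le (hA : ∀ w ∈ Ω, A w ⊆ u) (h : IsSpread Ω A N p)
    {W : Finset α} {T : ι → Finset α} (hT : ∀ w ∈ Ω, T w ⊆ A w ∧ IsFragment Ω A W (T w)) :
    (#{w ∈ Ω | l < 2 * #(T w)} : ℝ) ≤ N * ∑ R ∈ largeFragments Ω A u l W, p ^ #R := by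
  have hmaps : ∀ w ∈ {w ∈ Ω | l < 2 * #(T w)}, T w ∈ largeFragments Ω A u l W := by
    intro w hw
    obtain ⟨hw, hl⟩ := mem_filter.1 hw
    exact mem_largeFragments.2 ⟨(hT w hw).1.trans (hA w hw), hl, (hT w hw).2⟩
  rw [card_eq_sum_card_fiberwise hmaps, Nat.cast_sum, mul_sum]
  refine sum_le_sum fun R hR => ?_
  have hR : R.Nonempty := card_pos.1 (by have := (mem_largeFragments.1 hR).2.1; omega)
  refine le_trans (Nat.cast_le.2 (card_le_card fun w hw => ?_)) (h R hR)
  simp only [mem_filter] at hw ⊢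
  exact ⟨hw.1.1, hw.2 ▸ (hT w hw.1.1).1⟩

lemma card_mul_missProb_of_forall_eq_empty (hA : ∀ w ∈ Ω, A w = ∅) (u : Finset α) (q : ℝ) :
    #Ω * missProb u q Ω A = 0 := by
  rcases Ω.eq_empty_or_nonempty with rfl | ⟨w, hw⟩
  · simp
  · have hmem : ∀ W, ∃ w ∈ Ω, A w ⊆ W := fun W => ⟨w, hw, hA w hw ▸ empty_subset W⟩
    simp only [missProb, hmem, if_true, bernoulliExpect_const, mul_zero]

lemma card_mul_missProb_le_of_subset_union {W : Finset α} {q : ℝ} (hq₀ : 0 ≤ q) (hq₁ : q ≤ 1)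
    {T : ι → Finset α} (hT : ∀ w ∈ Ω, IsFragment Ω A W (T w)) :
    (#Ω : ℝ) * missProb u q Ω (fun w => A w \ W) ≤
      #{w ∈ Ω | l < 2 * #(T w)} +
        #{w ∈ Ω | ¬ l < 2 * #(T w)} * missProb u q {w ∈ Ω | ¬ l < 2 * #(T w)} T := by
  classical
  set small := Ω.filter fun w => ¬ l < 2 * #(T w)
  rw [missProb, missProb, ← bernoulliExpect_const_mul, ← bernoulliExpect_const_mul,
    ← bernoulliExpect_const u q (#{w ∈ Ω | l < 2 * #(T w)} : ℝ), ← bernoulliExpect_add]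
  refine bernoulliExpect_mono hq₀ hq₁ fun W' _ => ?_
  by_cases h : ∃ w ∈ Ω, A w \ W ⊆ W'
  · rw [if_pos h, mul_zero]
    split_ifs <;> positivity
  · have h' : ¬ ∃ w ∈ small, T w ⊆ W' := by
      rintro ⟨w, hw, hwT⟩
      obtain ⟨-, ⟨v, hv, hvT⟩, -⟩ := hT w (mem_filter.1 hw).1
      exact h ⟨v, hv, (sdiff_le_iff.2 hvT).trans hwT⟩
    rw [if_neg h, if_neg h', mul_one, mul_one]
    exact_mod_cast (card_filter_add_card_filter_not (s := Ω) fun w => l < 2 * #(T w)).ge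

lemma missProb_union (u : Finset α) (q r : ℝ) (Ω : Finset ι) (A : ι → Finset α) :
    bernoulliExpect u q (fun W => missProb u r Ω fun w => A w \ W) =
      missProb u (1 - (1 - q) * (1 - r)) Ω A := by
  simp only [missProb, ← bernoulliExpect_union, sdiff_le_iff, sup_eq_union]

/-- One round: exposing a random set `W` of density `64 p` leaves, outside an expected loss of
`N / 4 ^ l`, the family of the fragments over `W` of size at most `l / 2`. -/
lemma card_mul_missProb_union_le (hp₀ : 0 ≤ p) (hp₁ : 64 * p ≤ 1) (hN : 0 ≤ N)
    (hA : ∀ w ∈ Ω, A w ⊆ u) (hl : ∀ w ∈ Ω, #(A w) ≤ l) (h : IsSpread Ω A N p)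
    {q M : ℝ} (hq₀ : 0 ≤ q) (hq₁ : q ≤ 1) {T : Finset α → ι → Finset α}
    (hT : ∀ W, ∀ w ∈ Ω, T W w ⊆ A w ∧ IsFragment Ω A W (T W w))
    (hM : ∀ W, #{w ∈ Ω | ¬ l < 2 * #(T W w)} *
      missProb u q {w ∈ Ω | ¬ l < 2 * #(T W w)} (T W) ≤ M) :
    #Ω * missProb u (1 - (1 - 64 * p) * (1 - q)) Ω A ≤ N * (1 / 4) ^ l + M :=
  calc #Ω * missProb u (1 - (1 - 64 * p) * (1 - q)) Ω A
      = bernoulliExpect u (64 * p) fun W => #Ω * missProb u q Ω fun w => A w \ W := by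
        rw [bernoulliExpect_const_mul, missProb_union]
    _ ≤ bernoulliExpect u (64 * p)
          fun W => N * ∑ R ∈ largeFragments Ω A u l W, p ^ #R + M :=
        bernoulliExpect_mono (by positivity) hp₁ fun W _ =>
          (card_mul_missProb_le_of_subset_union hq₀ hq₁ fun w hw => (hT W w hw).2).trans
            (add_le_add (card_filter_large_isFragment_le hA h (hT W)) (hM W))
    _ ≤ N * (1 / 4) ^ l + M := by
        rw [bernoulliExpect_add, bernoulliExpect_const_mul, bernoulliExpect_const]
        gcongr
        exact bernoulliExpect_largeFragments_le hl hp₀ hp₁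

theorem card_mul_missProb_le (hp₀ : 0 ≤ p) (hp₁ : 64 * p ≤ 1) (hN : 0 ≤ N) {k : ℕ}
    (hk : l < 2 ^ k) (hA : ∀ w ∈ Ω, A w ⊆ u) (hl : ∀ w ∈ Ω, #(A w) ≤ l)
    (h : IsSpread Ω A N p) :
    #Ω * missProb u (1 - (1 - 64 * p) ^ k) Ω A ≤ N * ((1 - (1 / 4) ^ l) / 3) := by
  induction k generalizing l Ω A with
  | zero =>
    obtain rfl : l = 0 := by simpa using hk
    simp [card_mul_missProb_of_forall_eq_empty (A := A) fun w hw => by simpa using hl w hw]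
  | succ k ih =>
    rcases Nat.eq_zero_or_pos l with rfl | hl₀
    · simp [card_mul_missProb_of_forall_eq_empty (A := A) fun w hw => by simpa using hl w hw]
    have hfragment : ∀ W w, ∃ T, w ∈ Ω → T ⊆ A w ∧ IsFragment Ω A W T := fun W w => by
      by_cases hw : w ∈ Ω
      · exact (exists_subset_isFragment A W hw).imp fun _ hT _ => hT
      · exact ⟨∅, fun hw' => absurd hw' hw⟩
    choose T hT using hfragment
    have hpow₀ : 0 ≤ (1 - 64 * p) ^ k := pow_nonneg (sub_nonneg.2 hp₁) k
    have hpow₁ : (1 - 64 * p) ^ k ≤ 1 := pow_le_one₀ (sub_nonneg.2 hp₁) (by linarith)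
    have hround := card_mul_missProb_union_le hp₀ hp₁ hN hA hl h
      (sub_nonneg.2 hpow₁) (sub_le_self 1 hpow₀) hT fun W =>
        ih (l := l / 2) (by omega)
          (fun w hw => (hT W w (filter_subset _ _ hw)).1.trans (hA w (filter_subset _ _ hw)))
          (fun w hw => by have := (mem_filter.1 hw).2; omega)
          (h.mono (filter_subset _ _) fun w hw => (hT W w (filter_subset _ _ hw)).1)
    have hquarter : 4 * (1 / 4 : ℝ) ^ l ≤ (1 / 4) ^ (l / 2) := calc
      4 * (1 / 4 : ℝ) ^ l ≤ 4 * (1 / 4) ^ (l / 2 + 1) :=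
        mul_le_mul_of_nonneg_left
          (pow_le_pow_of_le_one (by norm_num) (by norm_num) (by omega)) (by norm_num)
      _ = (1 / 4) ^ (l / 2) := by rw [pow_succ]; ring
    calc #Ω * missProb u (1 - (1 - 64 * p) ^ (k + 1)) Ω A
        ≤ N * (1 / 4) ^ l + N * ((1 - (1 / 4) ^ (l / 2)) / 3) := by
          rwa [sub_sub_cancel, ← pow_succ'] at hround
      _ ≤ N * ((1 - (1 / 4) ^ l) / 3) := by
          rw [← mul_add]
          exact mul_le_mul_of_nonneg_left (by linarith) hN

end Spread

section Copies

variable {W U : Type*}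

instance [Finite W] [Finite U] (J : SimpleGraph W) (G : SimpleGraph U) : Finite (Copy J G) :=
  DFunLike.finite _

instance [Finite W] [Finite U] (J : SimpleGraph W) (G : SimpleGraph U) : Finite (J ≃g G) :=
  DFunLike.finite _

/-- A labelled copy of `J` in `G` is an injection of the vertices under which the image of `J` is a
subgraph of `G`. -/
def copyEquivEmbedding (J : SimpleGraph W) (G : SimpleGraph U) :
    Copy J G ≃ {φ : W ↪ U // J.map φ ≤ G} where
  toFun f := ⟨f.toEmbedding, (map_le_iff_le_comap _ _ _).2 fun _ _ h => f.toHom.map_adj h⟩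
  invFun φ := ⟨⟨φ.1, fun h => (map_le_iff_le_comap _ _ _).1 φ.2 h⟩, φ.1.injective⟩

lemma natCard_iso_congr {J : SimpleGraph W} {G : SimpleGraph U} (e : J ≃g G) :
    Nat.card (J ≃g J) = Nat.card (G ≃g G) :=
  Nat.card_congr ⟨fun α => (e.symm.trans α).trans e, fun α => (e.trans α).trans e.symm,
    fun α => by ext; simp, fun α => by ext; simp⟩

lemma toSubgraph_comp_toCopy {J : SimpleGraph W} {G : SimpleGraph U} (f : Copy J G)
    (α : J ≃g J) : (f.comp α.toCopy).toSubgraph = f.toSubgraph := by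
  change Subgraph.map (f.toHom.comp α.toHom) ⊤ = _
  rw [Subgraph.map_comp, Subgraph.map_iso_top]

lemma copyCount_mul_natCard_iso_le [Finite W] [Fintype U] (J : SimpleGraph W)
    (G : SimpleGraph U) : G.copyCount J * Nat.card (J ≃g J) ≤ Nat.card (Copy J G) := by
  classical
  have hcopy : ∀ G' : {G' : G.Subgraph // Nonempty (J ≃g G'.coe)},
      ∃ f : Copy J G, f.toSubgraph = G' := fun G' => by
    obtain ⟨f, -, hf⟩ := Copy.toSubgraph_surjOn G'.2
    exact ⟨f, hf⟩
  choose f hf using hcopy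
  rw [copyCount, ← Fintype.card_subtype, ← Nat.card_eq_fintype_card, ← Nat.card_prod]
  refine Nat.card_le_card_of_injective (fun x => (f x.1).comp x.2.toCopy) ?_
  rintro ⟨G₁, α⟩ ⟨G₂, β⟩ h
  obtain rfl : G₁ = G₂ := Subtype.ext <| calc
    G₁.1 = ((f G₁).comp α.toCopy).toSubgraph := by rw [toSubgraph_comp_toCopy, hf]
    _ = ((f G₂).comp β.toCopy).toSubgraph := congrArg Copy.toSubgraph h
    _ = G₂.1 := by rw [toSubgraph_comp_toCopy, hf]
  have hαβ : α = β := by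
    ext w
    exact (f G₁).injective (DFunLike.congr_fun h w)
  rw [hαβ]

end Copies

section RandomGraph

variable {n : ℕ} {V W : Type*} {H : SimpleGraph V} {p : unitInterval}

lemma integral_binomialRandom_eq_bernoulliExpect (n : ℕ) (p : unitInterval)
    (f : SimpleGraph (Fin n) → ℝ) :
    ∫ G, f G ∂(binomialRandom (Fin n) p) =
      bernoulliExpect (⊤ : SimpleGraph (Fin n)).edgeFinset p fun S => f (fromEdgeSet S) := by
  classical
  rw [integral_binomialRandom, bernoulliExpect]
  refine sum_bij' (fun G _ => G.edgeFinset) (fun S _ => fromEdgeSet S)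
    (fun G _ => mem_powerset.2 (edgeFinset_mono le_top)) (by simp) (by simp) ?_ ?_
  · intro S hS
    ext e
    simp only [mem_edgeFinset, edgeSet_fromEdgeSet]
    exact ⟨fun h => h.1, fun h => ⟨h, by simpa using mem_powerset.1 hS h⟩⟩
  · intro G _
    rw [bernoulliWeight, ← coe_edgeFinset, Set.ncard_coe_finset,
      card_edgeFinset_top_eq_card_choose_two, Fintype.card_fin, coe_edgeFinset,
      fromEdgeSet_edgeSet]

lemma natCard_copy_fromEdgeSet {U : Type*} [DecidableEq U]
    (J : SimpleGraph W) [∀ φ : W ↪ U, Fintype (J.map φ).edgeSet] [Fintype (W ↪ U)]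
    (S : Finset (Sym2 U)) :
    (Nat.card (Copy J (fromEdgeSet (S : Set (Sym2 U)))) : ℝ) =
      ∑ φ : W ↪ U, if (J.map φ).edgeFinset ⊆ S then 1 else 0 := by
  have hle : ∀ φ : W ↪ U,
      J.map φ ≤ fromEdgeSet (S : Set (Sym2 U)) ↔ (J.map φ).edgeFinset ⊆ S := fun φ => by
    rw [le_fromEdgeSet_iff, ← coe_edgeFinset, coe_subset]
  rw [sum_boole, ← Fintype.card_subtype, ← Nat.card_eq_fintype_card,
    Nat.card_congr (copyEquivEmbedding J _)]
  simp only [hle]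

lemma expCopies_mul_natCard_iso_le (n : ℕ) [Fintype W] (J : SimpleGraph W) (p : unitInterval) :
    expCopies n J p * Nat.card (J ≃g J) ≤
      (n : ℝ) ^ Fintype.card W * (p : ℝ) ^ Nat.card J.edgeSet := by
  classical
  set u := (⊤ : SimpleGraph (Fin n)).edgeFinset
  calc expCopies n J p * Nat.card (J ≃g J)
      = bernoulliExpect u p fun S =>
          Nat.card (J ≃g J) * ((fromEdgeSet (S : Set (Sym2 (Fin n)))).copyCount J : ℝ) := by
        rw [expCopies, integral_binomialRandom_eq_bernoulliExpect, bernoulliExpect_const_mul,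
          mul_comm]
    _ ≤ bernoulliExpect u p fun S =>
          ∑ φ : W ↪ Fin n, if (J.map φ).edgeFinset ⊆ S then 1 else 0 := by
        refine bernoulliExpect_mono p.2.1 p.2.2 fun S _ => ?_
        rw [← natCard_copy_fromEdgeSet, mul_comm]
        exact_mod_cast copyCount_mul_natCard_iso_le J (fromEdgeSet (S : Set (Sym2 (Fin n))))
    _ = ∑ _φ : W ↪ Fin n, (p : ℝ) ^ Nat.card J.edgeSet := by
        simp only [bernoulliExpect, mul_sum]
        rw [sum_comm]
        refine sum_congr rfl fun φ _ => ?_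
        rw [Nat.card_eq_fintype_card, card_edgeSet, ← card_edgeFinset_map φ J]
        exact bernoulliExpect_superset (edgeFinset_mono le_top) _
    _ ≤ (n : ℝ) ^ Fintype.card W * (p : ℝ) ^ Nat.card J.edgeSet := by
        rw [sum_const, nsmul_eq_mul, card_univ, Fintype.card_embedding_eq, Fintype.card_fin]
        refine mul_le_mul_of_nonneg_right ?_ (pow_nonneg p.2.1 _)
        exact_mod_cast Nat.descFactorial_le_pow n _

lemma natCard_iso_le_of_isContained [Finite V] [Fintype W]
    (hp : ∀ I : H.Subgraph, 1 / 2 ≤ expCopies n I.coe p) {J : SimpleGraph W}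
    (hJ : J.IsContained H) :
    (Nat.card (J ≃g J) : ℝ) ≤ 2 * ((n : ℝ) ^ Fintype.card W * (p : ℝ) ^ Nat.card J.edgeSet) := by
  classical
  cases nonempty_fintype V
  obtain ⟨f⟩ := hJ
  let e := f.isoToSubgraph
  rw [natCard_iso_congr e, Fintype.card_congr e.toEquiv, Nat.card_congr e.mapEdgeSet]
  have hexp := mul_le_mul_of_nonneg_right (hp f.toSubgraph)
    (Nat.cast_nonneg (α := ℝ) (Nat.card (f.toSubgraph.coe ≃g f.toSubgraph.coe)))
  linarith [expCopies_mul_natCard_iso_le n f.toSubgraph.coe p]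

lemma natCard_edgeSet_cycleGraph (m : ℕ) : Nat.card (cycleGraph (m + 3)).edgeSet = m + 3 := by
  have hsum := sum_degrees_eq_twice_card_edges (cycleGraph (m + 3))
  simp only [cycleGraph_degree_three_le, sum_const, card_univ, Fintype.card_fin,
    smul_eq_mul] at hsum
  rw [Nat.card_eq_fintype_card, card_edgeSet]
  omega

theorem isAcyclic_of_half_le_expCopies [Finite V]
    (hp : ∀ I : H.Subgraph, 1 / 2 ≤ expCopies n I.coe p) (hnp : 2 * ((n : ℝ) * p) < 1) :
    H.IsAcyclic := by
  rw [isAcyclic_iff_free_cycleGraph]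
  intro k hk hcycle
  obtain ⟨m, rfl⟩ : ∃ m, k = m + 3 := ⟨k - 3, by omega⟩
  have hnp₀ : 0 ≤ (n : ℝ) * p := mul_nonneg (Nat.cast_nonneg n) p.2.1
  have haut := natCard_iso_le_of_isContained hp hcycle
  rw [natCard_edgeSet_cycleGraph, Fintype.card_fin, ← mul_pow] at haut
  have hone : (1 : ℝ) ≤ Nat.card (cycleGraph (m + 3) ≃g cycleGraph (m + 3)) := by
    have : Nonempty (cycleGraph (m + 3) ≃g cycleGraph (m + 3)) := ⟨.refl⟩
    exact_mod_cast Nat.card_pos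
  have hpow : ((n : ℝ) * p) ^ (m + 3) ≤ n * p :=
    pow_le_of_le_one hnp₀ (by linarith) (by omega)
  linarith

end RandomGraph

section IsoClass

variable {ι V W : Type*}

/-- The automorphism of the disjoint union of copies of `G` which permutes the copies by `σ` and
applies an automorphism of `G` to each of them. -/
def boxProdBotAut (G : SimpleGraph W) (σ : Equiv.Perm ι) (α : ι → (G ≃g G)) :
    ((⊥ : SimpleGraph ι) □ G) ≃g ((⊥ : SimpleGraph ι) □ G) where
  toFun x := (σ x.1, α x.1 x.2)
  invFun x := (σ.symm x.1, (α (σ.symm x.1)).symm x.2)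
  left_inv x := by simp
  right_inv x := by simp
  map_rel_iff' := by
    rintro ⟨i, a⟩ ⟨j, b⟩
    simp only [Equiv.coe_fn_mk, boxProd_adj, bot_adj, false_and, false_or,
      EmbeddingLike.apply_eq_iff_eq]
    exact and_congr_left fun h => by rw [h, (α j).map_adj_iff]

lemma factorial_mul_natCard_iso_pow_le [Fintype ι] [Finite W] [Nonempty W] (G : SimpleGraph W) :
    (Fintype.card ι).factorial * Nat.card (G ≃g G) ^ Fintype.card ι ≤
      Nat.card (((⊥ : SimpleGraph ι) □ G) ≃g ((⊥ : SimpleGraph ι) □ G)) := by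
  classical
  rw [← Fintype.card_perm, ← Nat.card_eq_fintype_card, ← Nat.card_eq_fintype_card (α := ι),
    ← Nat.card_fun, ← Nat.card_prod]
  refine Nat.card_le_card_of_injective (fun x => boxProdBotAut G x.1 x.2) ?_
  rintro ⟨σ, α⟩ ⟨τ, β⟩ hxy
  have hpt : ∀ i a, (σ i, α i a) = (τ i, β i a) := fun i a => DFunLike.congr_fun hxy (i, a)
  obtain ⟨w⟩ := ‹Nonempty W›
  have hστ : σ = τ := Equiv.ext fun i => (Prod.ext_iff.1 (hpt i w)).1
  have hαβ : α = β := funext fun i => RelIso.ext fun a => (Prod.ext_iff.1 (hpt i a)).2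
  rw [hστ, hαβ]

lemma natCard_mul_natCard_edgeSet_le [Finite ι] [Finite W] (G : SimpleGraph W) :
    Nat.card ι * Nat.card G.edgeSet ≤ Nat.card ((⊥ : SimpleGraph ι) □ G).edgeSet := by
  rw [← Nat.card_prod]
  let f : ι → G →g ((⊥ : SimpleGraph ι) □ G) := fun i => ⟨fun a => (i, a), fun h => by simp [h]⟩
  refine Nat.card_le_card_of_injective (fun x => (f x.1).mapEdgeSet x.2) ?_
  rintro ⟨i, e, he⟩ ⟨j, e', he'⟩ h
  have hmap : Sym2.map (f i) e = Sym2.map (f j) e' := congrArg Subtype.val h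
  induction e with | _ a b
  induction e' with | _ c d
  simp only [Sym2.map_mk, f, RelHom.coeFn_mk, Sym2.eq_iff, Prod.mk.injEq] at hmap
  obtain rfl : i = j := by tauto
  have hedge : s(a, b) = s(c, d) := Sym2.eq_iff.2 (by tauto)
  simp only [hedge]

/-- The number of isomorphisms of `G` onto the components of `H`. -/
noncomputable def componentIsoCount (G : SimpleGraph W) (H : SimpleGraph V) : ℕ :=
  Nat.card (Σ D : H.ConnectedComponent, G ≃g D.toSimpleGraph)

lemma componentIsoCount_congr {U : Type*} {G : SimpleGraph W} {G' : SimpleGraph U} (e : G ≃g G')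
    (H : SimpleGraph V) : componentIsoCount G H = componentIsoCount G' H :=
  Nat.card_congr <| .sigmaCongrRight fun _ =>
    ⟨e.symm.trans, e.trans, fun α => by ext; simp, fun α => by ext; simp⟩

/-- The components of `H` which are isomorphic to the component `D`. -/
def isoClass (H : SimpleGraph V) (D : H.ConnectedComponent) : Set H.ConnectedComponent :=
  {D' | Nonempty (D.toSimpleGraph ≃g D'.toSimpleGraph)}

variable {H : SimpleGraph V}

lemma mem_isoClass_self (D : H.ConnectedComponent) : D ∈ isoClass H D := ⟨.refl⟩

lemma componentIsoCount_le [Finite V] (D : H.ConnectedComponent) :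
    componentIsoCount D.toSimpleGraph H ≤
      Nat.card (isoClass H D) * Nat.card (D.toSimpleGraph ≃g D.toSimpleGraph) := by
  let e : ∀ D' : isoClass H D, D.toSimpleGraph ≃g D'.1.toSimpleGraph := fun D' => D'.2.some
  rw [componentIsoCount, ← Nat.card_prod]
  refine Nat.card_le_card_of_injective
    (fun x => (⟨x.1, ⟨x.2⟩⟩, x.2.trans (e ⟨x.1, ⟨x.2⟩⟩).symm)) ?_
  rintro ⟨D₁, α⟩ ⟨D₂, β⟩ h
  obtain ⟨hD, hαβ⟩ := Prod.mk.inj h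
  obtain rfl : D₁ = D₂ := congrArg Subtype.val hD
  have : α = β := by
    ext a : 1
    exact (e ⟨D₁, ⟨α⟩⟩).symm.injective (DFunLike.congr_fun hαβ a)
  rw [this]

lemma isContained_boxProd_isoClass (D : H.ConnectedComponent) :
    ((⊥ : SimpleGraph (isoClass H D)) □ D.toSimpleGraph).IsContained H := by
  let e : ∀ D' : isoClass H D, D.toSimpleGraph ≃g D'.1.toSimpleGraph := fun D' => D'.2.some
  have hmk : ∀ D' a, H.connectedComponentMk (e D' a : V) = D' := fun D' a => (e D' a).2
  refine ⟨⟨⟨fun x => (e x.1 x.2 : V), ?_⟩, ?_⟩⟩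
  · rintro ⟨i, a⟩ ⟨j, b⟩ h
    simp only [boxProd_adj, bot_adj, false_and, false_or] at h
    obtain ⟨h, rfl⟩ := h
    exact (e i).map_rel_iff.2 h
  · rintro ⟨i, a⟩ ⟨j, b⟩ h
    have hval : (e i a : V) = e j b := h
    obtain rfl : i = j := Subtype.ext (by rw [← hmk i a, ← hmk j b, hval])
    rw [(e i).injective (Subtype.ext hval)]

lemma pow_le_exp_mul_factorial (m : ℕ) : (m : ℝ) ^ m ≤ Real.exp m * m.factorial :=
  (div_le_iff₀ (by positivity)).1 (Real.pow_div_factorial_le_exp _ (Nat.cast_nonneg m) m)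

lemma mul_le_of_factorial_mul_pow_le {m : ℕ} (hm : m ≠ 0) {a X : ℝ} (ha : 0 ≤ a) (hX : 0 ≤ X)
    (h : m.factorial * a ^ m ≤ 2 * X ^ m) : m * a ≤ 2 * Real.exp 1 * X := by
  refine le_of_pow_le_pow_left₀ hm (by positivity) ?_
  calc ((m : ℝ) * a) ^ m = (m : ℝ) ^ m * a ^ m := mul_pow _ _ _
    _ ≤ Real.exp m * m.factorial * a ^ m := by gcongr; exact pow_le_exp_mul_factorial m
    _ = Real.exp m * (m.factorial * a ^ m) := mul_assoc _ _ _
    _ ≤ Real.exp m * (2 * X ^ m) := by gcongr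
    _ ≤ Real.exp m * (2 ^ m * X ^ m) := by gcongr; exact le_self_pow₀ one_le_two hm
    _ = (2 * Real.exp 1 * X) ^ m := by rw [← Real.exp_one_pow, mul_pow, mul_pow]; ring

lemma factorial_mul_natCard_iso_pow_le_of_half_le_expCopies [Finite V] {n : ℕ} {p : unitInterval}
    (hp : ∀ I : H.Subgraph, 1 / 2 ≤ expCopies n I.coe p) (D : H.ConnectedComponent) :
    ((Nat.card (isoClass H D)).factorial : ℝ) *
        (Nat.card (D.toSimpleGraph ≃g D.toSimpleGraph) : ℝ) ^ Nat.card (isoClass H D) ≤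
      2 * (n * ((n : ℝ) * p) ^ (Nat.card D - 1)) ^ Nat.card (isoClass H D) := by
  classical
  cases nonempty_fintype V
  have : Fintype (isoClass H D) := Fintype.ofFinite _
  have : Nonempty D := D.connected_toSimpleGraph.nonempty
  have hcontained := natCard_iso_le_of_isContained hp (isContained_boxProd_isoClass D)
  have haut := factorial_mul_natCard_iso_pow_le (ι := isoClass H D) D.toSimpleGraph
  rw [Fintype.card_prod, ← Nat.card_eq_fintype_card, ← Nat.card_eq_fintype_card] at hcontained
  rw [← Nat.card_eq_fintype_card] at haut
  set m := Nat.card (isoClass H D)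
  obtain ⟨s, hs⟩ := Nat.exists_eq_succ_of_ne_zero (Nat.card_pos (α := D)).ne'
  have hedges : m * s ≤ Nat.card ((⊥ : SimpleGraph (isoClass H D)) □ D.toSimpleGraph).edgeSet := by
    have := D.connected_toSimpleGraph.card_vert_le_card_edgeSet_add_one
    exact (Nat.mul_le_mul_left m (by omega)).trans (natCard_mul_natCard_edgeSet_le _)
  calc (m.factorial : ℝ) * (Nat.card (D.toSimpleGraph ≃g D.toSimpleGraph) : ℝ) ^ m
      ≤ Nat.card (((⊥ : SimpleGraph (isoClass H D)) □ D.toSimpleGraph) ≃g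
          ((⊥ : SimpleGraph (isoClass H D)) □ D.toSimpleGraph)) := by exact_mod_cast haut
    _ ≤ 2 * ((n : ℝ) ^ (m * (s + 1)) * (p : ℝ) ^ (m * s)) := by
        rw [hs] at hcontained
        refine hcontained.trans ?_
        gcongr 2 * (_ * ?_)
        exact pow_le_pow_of_le_one p.2.1 p.2.2 hedges
    _ = 2 * (n * ((n : ℝ) * p) ^ (Nat.card D - 1)) ^ m := by
        rw [hs, Nat.succ_sub_one]; ring

/-- A component with many automorphisms has few isomorphic copies among the components, for the
disjoint union of these copies has few automorphisms. -/
lemma componentIsoCount_le_of_half_le_expCopies [Finite V] {n : ℕ} {p : unitInterval}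
    (hp : ∀ I : H.Subgraph, 1 / 2 ≤ expCopies n I.coe p) (D : H.ConnectedComponent) :
    (componentIsoCount D.toSimpleGraph H : ℝ) ≤
      2 * Real.exp 1 * (n * ((n : ℝ) * p) ^ (Nat.card D - 1)) := by
  have : Nonempty (isoClass H D) := ⟨⟨D, mem_isoClass_self D⟩⟩
  have hp₀ : (0 : ℝ) ≤ p := p.2.1
  calc (componentIsoCount D.toSimpleGraph H : ℝ)
      ≤ Nat.card (isoClass H D) * Nat.card (D.toSimpleGraph ≃g D.toSimpleGraph) := by
        exact_mod_cast componentIsoCount_le D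
    _ ≤ _ := mul_le_of_factorial_mul_pow_le Nat.card_pos.ne' (Nat.cast_nonneg _) (by positivity)
        (factorial_mul_natCard_iso_pow_le_of_half_le_expCopies hp D)

end IsoClass

section TreeExtensions

variable {τ U : Type*} {r : ℕ}

/-- The trees on `τ ⊕ Fin r` which contain the graph `T` on `τ`. -/
def treeExtensions (T : SimpleGraph τ) (r : ℕ) : Set (SimpleGraph (τ ⊕ Fin r)) :=
  {G | G.IsTree ∧ T.map .inl ≤ G}

/-- The graph on `τ ⊕ Fin r` obtained from `T` by joining every new vertex to its parent. -/
def parentGraph (T : SimpleGraph τ) (f : Fin r → τ ⊕ Fin r) : SimpleGraph (τ ⊕ Fin r) :=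
  T.map .inl ⊔ ⨆ i, edge (Sum.inr i) (f i)

lemma exists_adj_dist_lt {G : SimpleGraph U} (hG : G.Connected) {u v : U} (h : u ≠ v) :
    ∃ w, G.Adj u w ∧ G.dist w v < G.dist u v := by
  obtain ⟨P, hP⟩ := hG.exists_walk_length_eq_dist u v
  cases P with
  | nil => exact absurd rfl h
  | cons hadj P' =>
    refine ⟨_, hadj, ?_⟩
    rw [← hP, Walk.length_cons]
    exact Nat.lt_succ_of_le (dist_le P')

lemma parentGraph_connected {T : SimpleGraph τ} (hT : T.Connected) {f : Fin r → τ ⊕ Fin r}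
    (rank : τ ⊕ Fin r → ℕ) (hf : ∀ i, rank (f i) < rank (Sum.inr i)) :
    (parentGraph T f).Connected := by
  obtain ⟨root⟩ := hT.nonempty
  have hreach : ∀ k, ∀ x, rank x = k → (parentGraph T f).Reachable x (Sum.inl root) := by
    intro k
    induction k using Nat.strong_induction_on with | _ k ih
    rintro (a | i) hx
    · exact ((hT.preconnected a root).map (Embedding.map .inl T).toHom).mono le_sup_left
    · have hadj : (parentGraph T f).Adj (Sum.inr i) (f i) :=
        Or.inr (iSup_adj.2 ⟨i, (edge_adj ..).2 ⟨by simp, fun h => (hf i).ne (by rw [← h])⟩⟩)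
      exact hadj.reachable.trans (ih _ (hx ▸ hf i) _ rfl)
  have : Nonempty (τ ⊕ Fin r) := ⟨Sum.inl root⟩
  exact ⟨fun x y => (hreach _ x rfl).trans (hreach _ y rfl).symm⟩

/-- Rooted in `τ`, an extension of `T` is determined by the parents of the new vertices. -/
lemma exists_parentGraph_eq {T : SimpleGraph τ} (hT : T.Connected) {G : SimpleGraph (τ ⊕ Fin r)}
    (hG : G ∈ treeExtensions T r) : ∃ f, parentGraph T f = G := by
  obtain ⟨hGtree, hTG⟩ := hG
  obtain ⟨root⟩ := hT.nonempty
  choose f hadj hdist using fun i : Fin r =>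
    exists_adj_dist_lt hGtree.connected (u := Sum.inr i) (v := Sum.inl root) (by simp)
  have hle : parentGraph T f ≤ G :=
    sup_le hTG (iSup_le fun i => (edge_le_iff G).2 (Or.inr (hadj i)))
  exact ⟨f, hle.antisymm ((isTree_iff_minimal_connected.1 hGtree).2
    (parentGraph_connected hT (G.dist · (Sum.inl root)) hdist) hle)⟩

lemma ncard_treeExtensions_le [Finite τ] {T : SimpleGraph τ} (hT : T.Connected) (r : ℕ) :
    (treeExtensions T r).ncard ≤ (Nat.card τ + r) ^ r := by
  choose parent hparent using fun G : treeExtensions T r => exists_parentGraph_eq hT G.2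
  have hinj : Function.Injective parent := fun G G' h =>
    Subtype.ext (by rw [← hparent G, ← hparent G', h])
  have hcard := Nat.card_le_card_of_injective parent hinj
  rwa [Nat.card_coe_set_eq, Nat.card_fun, Nat.card_sum, Nat.card_fin] at hcard

end TreeExtensions

section TreeCopies

variable {V W τ : Type*} {H : SimpleGraph V} {T : SimpleGraph τ}

lemma sum_natCard_iso_div_componentIsoCount_le [Fintype H.ConnectedComponent] [Finite V]
    [Finite W] (G : SimpleGraph W) :
    ∑ D : H.ConnectedComponent,
      (Nat.card (G ≃g D.toSimpleGraph) : ℝ) / componentIsoCount D.toSimpleGraph H ≤ 1 := by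
  have hterm : ∀ D : H.ConnectedComponent,
      (Nat.card (G ≃g D.toSimpleGraph) : ℝ) / componentIsoCount D.toSimpleGraph H =
        Nat.card (G ≃g D.toSimpleGraph) / componentIsoCount G H := fun D => by
    rcases isEmpty_or_nonempty (G ≃g D.toSimpleGraph) with _ | ⟨⟨e⟩⟩
    · simp
    · rw [componentIsoCount_congr e]
  simp only [hterm]
  rw [← sum_div, ← Nat.cast_sum, ← Nat.card_sigma]
  exact div_self_le_one _

lemma natCard_equiv_compl_range [Finite W] [Finite τ] {f : τ → W} (hf : Function.Injective f)
    {r : ℕ} (hW : Nat.card W = Nat.card τ + r) :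
    Nat.card (Fin r ≃ ((Set.range f)ᶜ : Set W)) = r.factorial := by
  classical
  cases nonempty_fintype W
  have hcard : Nat.card ((Set.range f)ᶜ : Set W) = r := by
    have hsum := Nat.card_congr (Equiv.Set.sumCompl (Set.range f))
    rw [Nat.card_sum, hW, ← Nat.card_congr (Equiv.ofInjective f hf)] at hsum
    omega
  rw [Nat.card_eq_fintype_card, Fintype.card_equiv (Finite.equivFinOfCardEq hcard).symm,
    Fintype.card_fin]

lemma natCard_copy_mul_factorial_le [Finite W] [Finite τ] {G : SimpleGraph W} (hG : G.IsTree)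
    {r : ℕ} (hW : Nat.card W = Nat.card τ + r) :
    Nat.card (Copy T G) * r.factorial ≤ Nat.card (Σ G' : treeExtensions T r, G'.1 ≃g G) := by
  classical
  have : Fintype (Copy T G) := Fintype.ofFinite _
  let β : (Σ f : Copy T G, Fin r ≃ ((Set.range f)ᶜ : Set W)) → (τ ⊕ Fin r ≃ W) := fun x =>
    ((Equiv.ofInjective x.1 x.1.injective).sumCongr x.2).trans (Equiv.Set.sumCompl (Set.range x.1))
  have hβ : ∀ x, G.comap (β x) ∈ treeExtensions T r := fun x =>
    ⟨(Iso.comap (β x) G).isTree_iff.2 hG,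
      (map_le_iff_le_comap .inl T _).2 fun _ _ h => x.1.toHom.map_adj h⟩
  have hcard : Nat.card (Σ f : Copy T G, Fin r ≃ ((Set.range f)ᶜ : Set W)) =
      Nat.card (Copy T G) * r.factorial := by
    rw [Nat.card_sigma, sum_congr rfl fun f _ => natCard_equiv_compl_range f.injective hW,
      sum_const, card_univ, smul_eq_mul, Nat.card_eq_fintype_card]
  rw [← hcard]
  refine Nat.card_le_card_of_injective (fun x => ⟨⟨_, hβ x⟩, Iso.comap (β x) G⟩) ?_
  rintro ⟨f, σ⟩ ⟨f', σ'⟩ h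
  have happly : ∀ x y : (Σ G' : treeExtensions T r, G'.1 ≃g G), x = y → ∀ a, x.2 a = y.2 a := by
    rintro x _ rfl a; rfl
  obtain rfl : f = f' := Copy.ext fun a => happly _ _ h (Sum.inl a)
  obtain rfl : σ = σ' := Equiv.ext fun i => Subtype.ext (happly _ _ h (Sum.inr i))
  rfl

variable [Finite V] [Finite τ]

lemma sum_natCard_copy_div_componentIsoCount_le [Fintype H.ConnectedComponent]
    (hH : H.IsAcyclic) (hT : T.Connected) (r : ℕ) :
    ∑ D ∈ {D : H.ConnectedComponent | Nat.card D = Nat.card τ + r},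
      (Nat.card (Copy T D.toSimpleGraph) : ℝ) / componentIsoCount D.toSimpleGraph H ≤
      ((Nat.card τ + r : ℕ) : ℝ) ^ r / r.factorial := by
  classical
  have : Fintype (treeExtensions T r) := Fintype.ofFinite _
  rw [le_div_iff₀ (by positivity), sum_mul]
  calc ∑ D ∈ {D : H.ConnectedComponent | Nat.card D = Nat.card τ + r},
        (Nat.card (Copy T D.toSimpleGraph) : ℝ) / componentIsoCount D.toSimpleGraph H * r.factorial
      ≤ ∑ D ∈ {D : H.ConnectedComponent | Nat.card D = Nat.card τ + r},
        ∑ G : treeExtensions T r,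
          (Nat.card (G.1 ≃g D.toSimpleGraph) : ℝ) / componentIsoCount D.toSimpleGraph H := by
        refine sum_le_sum fun D hD => ?_
        have hcard := natCard_copy_mul_factorial_le (T := T) (hH.isTree_connectedComponent D)
          (mem_filter.1 hD).2
        rw [Nat.card_sigma] at hcard
        rw [← sum_div, div_mul_eq_mul_div]
        gcongr
        exact_mod_cast hcard
    _ ≤ ∑ D : H.ConnectedComponent, ∑ G : treeExtensions T r,
          (Nat.card (G.1 ≃g D.toSimpleGraph) : ℝ) / componentIsoCount D.toSimpleGraph H :=
        sum_le_univ_sum_of_nonneg fun D => sum_nonneg fun G _ => by positivity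
    _ ≤ ∑ G : treeExtensions T r, 1 := by
        rw [sum_comm]
        exact sum_le_sum fun G _ => sum_natCard_iso_div_componentIsoCount_le G.1
    _ ≤ ((Nat.card τ + r : ℕ) : ℝ) ^ r := by
        rw [sum_const, nsmul_one, card_univ, ← Nat.card_eq_fintype_card, Nat.card_coe_set_eq]
        exact_mod_cast ncard_treeExtensions_le hT r

lemma natCard_copy_le_sum [Fintype H.ConnectedComponent] (hT : T.Connected) :
    Nat.card (Copy T H) ≤ ∑ D : H.ConnectedComponent, Nat.card (Copy T D.toSimpleGraph) := by
  obtain ⟨root⟩ := hT.nonempty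
  rw [← Nat.card_sigma]
  have hmem : ∀ (f : Copy T H) (a : τ), f a ∈ H.connectedComponentMk (f root) := fun f a =>
    ConnectedComponent.sound ((hT.preconnected a root).map f.toHom)
  refine Nat.card_le_card_of_injective (fun f => ⟨H.connectedComponentMk (f root),
    ⟨⟨fun a => ⟨f a, hmem f a⟩, fun h => f.toHom.map_adj h⟩,
      fun a b h => f.injective (congrArg Subtype.val h)⟩⟩) ?_
  intro f f' h
  have happly : ∀ x y : (Σ D : H.ConnectedComponent, Copy T D.toSimpleGraph), x = y →
      ∀ a, ((x.2 a : x.1) : V) = (y.2 a : y.1) := by rintro x _ rfl a; rfl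
  exact Copy.ext fun a => happly _ _ h a

lemma natCard_copy_le_sum_range [Fintype H.ConnectedComponent] (hT : T.Connected) :
    Nat.card (Copy T H) ≤ ∑ r ∈ range (Nat.card V + 1),
      ∑ D ∈ {D : H.ConnectedComponent | Nat.card D = Nat.card τ + r},
        Nat.card (Copy T D.toSimpleGraph) := by
  refine (natCard_copy_le_sum hT).trans_eq ?_
  have hne : ∀ D ∈ (univ : Finset H.ConnectedComponent),
      Nat.card (Copy T D.toSimpleGraph) ≠ 0 → Nat.card τ ≤ Nat.card D := fun D _ h => by
    obtain ⟨f⟩ := (Nat.card_ne_zero.1 h).1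
    exact Nat.card_le_card_of_injective f f.injective
  have hrange : ∀ D ∈ ({D | Nat.card τ ≤ Nat.card D} : Finset H.ConnectedComponent),
      Nat.card D - Nat.card τ ∈ range (Nat.card V + 1) := fun D _ => by
    have hle : Nat.card D ≤ Nat.card V := Nat.card_le_card_of_injective _ Subtype.val_injective
    exact mem_range.2 (by omega)
  rw [← sum_filter_of_ne hne, ← sum_fiberwise_of_maps_to hrange]
  refine sum_congr rfl fun r _ => sum_congr ?_ fun _ _ => rfl
  ext D
  simp only [mem_filter, mem_univ, true_and]
  omega

variable {n : ℕ} {p : unitInterval} {c : ℝ}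

lemma sum_natCard_copy_le [Fintype H.ConnectedComponent] (hH : H.IsAcyclic)
    (hp : ∀ I : H.Subgraph, 1 / 2 ≤ expCopies n I.coe p) (hT : T.Connected) (r : ℕ) :
    ∑ D ∈ {D : H.ConnectedComponent | Nat.card D = Nat.card τ + r},
      (Nat.card (Copy T D.toSimpleGraph) : ℝ) ≤
      2 * Real.exp 1 * (n * ((n : ℝ) * p) ^ (Nat.card τ + r - 1)) *
        Real.exp 1 ^ (Nat.card τ + r) := by
  have hp₀ : (0 : ℝ) ≤ p := p.2.1
  have hpos : ∀ D : H.ConnectedComponent, (componentIsoCount D.toSimpleGraph H : ℝ) ≠ 0 :=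
    fun D => by
      have : Nonempty (Σ D' : H.ConnectedComponent, D.toSimpleGraph ≃g D'.toSimpleGraph) :=
        ⟨⟨D, .refl⟩⟩
      exact_mod_cast Nat.card_pos.ne'
  calc ∑ D ∈ {D : H.ConnectedComponent | Nat.card D = Nat.card τ + r},
        (Nat.card (Copy T D.toSimpleGraph) : ℝ)
      ≤ ∑ D ∈ {D : H.ConnectedComponent | Nat.card D = Nat.card τ + r},
          2 * Real.exp 1 * (n * ((n : ℝ) * p) ^ (Nat.card τ + r - 1)) *
            (Nat.card (Copy T D.toSimpleGraph) / componentIsoCount D.toSimpleGraph H) := by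
        refine sum_le_sum fun D hD => ?_
        have hcount := componentIsoCount_le_of_half_le_expCopies hp D
        rw [(mem_filter.1 hD).2] at hcount
        refine (mul_div_cancel₀ _ (hpos D)).ge.trans ?_
        gcongr
    _ ≤ _ := by
        rw [← mul_sum]
        gcongr
        refine (sum_natCard_copy_div_componentIsoCount_le hH hT r).trans ?_
        rw [Real.exp_one_pow]
        exact Real.pow_div_factorial_le_exp _ (Nat.cast_nonneg _) r

lemma geom_sum_le_one_div {x y : ℝ} (hx : 0 ≤ x) (hxy : x ≤ y) (hy : y < 1) (m : ℕ) :
    ∑ r ∈ range m, x ^ r ≤ 1 / (1 - y) := by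
  rw [le_div_iff₀ (sub_pos.2 hy)]
  calc (∑ r ∈ range m, x ^ r) * (1 - y) ≤ (∑ r ∈ range m, x ^ r) * (1 - x) := by gcongr
    _ = 1 - x ^ m := geom_sum_mul_neg x m
    _ ≤ 1 := sub_le_self _ (pow_nonneg hx m)

lemma natCard_copy_le_mul_pow (hp : ∀ I : H.Subgraph, 1 / 2 ≤ expCopies n I.coe p)
    (hnp : (n : ℝ) * p ≤ c) (hc : Real.exp 1 * c < 1) (hT : T.Connected) {s : ℕ}
    (hs : Nat.card τ = s + 1) :
    (Nat.card (Copy T H) : ℝ) ≤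
      n * ((n : ℝ) * p) ^ s * (2 * Real.exp 1 ^ (s + 2) / (1 - Real.exp 1 * c)) := by
  classical
  have : Fintype H.ConnectedComponent := Fintype.ofFinite _
  have hnp₀ : 0 ≤ (n : ℝ) * p := mul_nonneg (Nat.cast_nonneg n) p.2.1
  have hH : H.IsAcyclic := isAcyclic_of_half_le_expCopies hp <| by
    nlinarith [Real.exp_one_gt_d9]
  calc (Nat.card (Copy T H) : ℝ)
      ≤ ∑ r ∈ range (Nat.card V + 1),
          ∑ D ∈ {D : H.ConnectedComponent | Nat.card D = Nat.card τ + r},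
            (Nat.card (Copy T D.toSimpleGraph) : ℝ) := by
        exact_mod_cast natCard_copy_le_sum_range (H := H) hT
    _ ≤ ∑ r ∈ range (Nat.card V + 1), 2 * Real.exp 1 *
          (n * ((n : ℝ) * p) ^ (Nat.card τ + r - 1)) * Real.exp 1 ^ (Nat.card τ + r) :=
        sum_le_sum fun r _ => sum_natCard_copy_le hH hp hT r
    _ = n * ((n : ℝ) * p) ^ s * (2 * Real.exp 1 ^ (s + 2)) *
          ∑ r ∈ range (Nat.card V + 1), (Real.exp 1 * ((n : ℝ) * p)) ^ r := by
        rw [mul_sum]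
        refine sum_congr rfl fun r _ => ?_
        rw [hs, show s + 1 + r - 1 = s + r by omega]
        ring
    _ ≤ n * ((n : ℝ) * p) ^ s * (2 * Real.exp 1 ^ (s + 2)) * (1 / (1 - Real.exp 1 * c)) := by
        gcongr
        exact geom_sum_le_one_div (by positivity) (by gcongr) hc _
    _ = n * ((n : ℝ) * p) ^ s * (2 * Real.exp 1 ^ (s + 2) / (1 - Real.exp 1 * c)) := by ring

/-- If `n * p ≤ c < 1 / e`, then each edge of a subgraph of `H` contributes at most a factor
`copyFactor c * (n * p)` to the bound for the number of its copies in `H`. -/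
noncomputable def copyFactor (c : ℝ) : ℝ :=
  2 * Real.exp 1 ^ 3 / (1 - Real.exp 1 * c)

lemma two_mul_exp_pow_div_le (hc₀ : 0 ≤ c) (hc : Real.exp 1 * c < 1) (s : ℕ) :
    2 * Real.exp 1 ^ (s + 3) / (1 - Real.exp 1 * c) ≤ copyFactor c ^ (s + 1) := by
  have hpos : 0 < 1 - Real.exp 1 * c := sub_pos.2 hc
  have hle : 1 - Real.exp 1 * c ≤ 2 := by nlinarith [Real.exp_pos 1]
  have hone : 1 ≤ 2 / (1 - Real.exp 1 * c) := (one_le_div hpos).2 hle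
  calc 2 * Real.exp 1 ^ (s + 3) / (1 - Real.exp 1 * c)
      = 2 / (1 - Real.exp 1 * c) * Real.exp 1 ^ (s + 3) := by ring
    _ ≤ (2 / (1 - Real.exp 1 * c)) ^ (s + 1) * Real.exp 1 ^ (3 * (s + 1)) := by
        gcongr
        · exact le_self_pow₀ hone s.succ_ne_zero
        · exact Real.one_le_exp zero_le_one
        · omega
    _ = copyFactor c ^ (s + 1) := by rw [copyFactor, pow_mul, ← mul_pow]; ring

lemma natCard_copy_le_of_connected (hn : Nat.card V ≤ n)
    (hp : ∀ I : H.Subgraph, 1 / 2 ≤ expCopies n I.coe p) (hnp : (n : ℝ) * p ≤ c)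
    (hc : Real.exp 1 * c < 1) (hT : T.Connected) :
    (Nat.card (Copy T H) : ℝ) ≤ n * (copyFactor c * ((n : ℝ) * p)) ^ (Nat.card τ - 1) := by
  have : Nonempty τ := hT.nonempty
  have hnp₀ : 0 ≤ (n : ℝ) * p := mul_nonneg (Nat.cast_nonneg n) p.2.1
  obtain ⟨s, hs⟩ := Nat.exists_eq_succ_of_ne_zero (Nat.card_pos (α := τ)).ne'
  rw [hs, Nat.succ_sub_one]
  obtain _ | s := s
  · have hcard : Nat.card (Copy T H) ≤ Nat.card (τ → V) :=
      Nat.card_le_card_of_injective (fun f => (f : τ → V)) DFunLike.coe_injective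
    rw [Nat.card_fun, hs, pow_one] at hcard
    rw [pow_zero, mul_one]
    exact_mod_cast hcard.trans hn
  · calc (Nat.card (Copy T H) : ℝ)
        ≤ n * ((n : ℝ) * p) ^ (s + 1) * (2 * Real.exp 1 ^ (s + 3) / (1 - Real.exp 1 * c)) :=
          natCard_copy_le_mul_pow hp hnp hc hT hs
      _ ≤ n * ((n : ℝ) * p) ^ (s + 1) * copyFactor c ^ (s + 1) := by
          gcongr
          exact two_mul_exp_pow_div_le (hnp₀.trans hnp) hc s
      _ = n * (copyFactor c * ((n : ℝ) * p)) ^ (s + 1) := by rw [mul_pow]; ring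

end TreeCopies

section Forests

variable {A V : Type*} [Finite A] {I : SimpleGraph A}

lemma sum_natCard_connectedComponent (I : SimpleGraph A) [Fintype I.ConnectedComponent] :
    ∑ C : I.ConnectedComponent, Nat.card C = Nat.card A := by
  rw [← Nat.card_sigma]
  exact Nat.card_congr (Equiv.sigmaFiberEquiv I.connectedComponentMk)

lemma sum_natCard_edgeSet_connectedComponent (I : SimpleGraph A)
    [Fintype I.ConnectedComponent] :
    ∑ C : I.ConnectedComponent, Nat.card C.toSimpleGraph.edgeSet = Nat.card I.edgeSet := by
  rw [← Nat.card_sigma]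
  refine Nat.card_eq_of_bijective
    (fun x : Σ C : I.ConnectedComponent, C.toSimpleGraph.edgeSet =>
      x.1.toSimpleGraph_hom.mapEdgeSet x.2) ⟨?_, ?_⟩
  · rintro ⟨C, e, he⟩ ⟨C', e', he'⟩ h
    have hmap : Sym2.map Subtype.val e = Sym2.map Subtype.val e' := congrArg Subtype.val h
    obtain rfl : C = C' := by
      induction e with | _ a b
      have ha : (a : A) ∈ Sym2.map Subtype.val e' :=
        hmap ▸ Sym2.mem_map.2 ⟨a, Sym2.mem_mk_left a b, rfl⟩
      obtain ⟨a', -, ha'⟩ := Sym2.mem_map.1 ha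
      have ha₀ : I.connectedComponentMk a = C := a.2
      rw [← ha₀, ← ha']
      exact a'.2
    obtain rfl : e = e' := Sym2.map.injective Subtype.val_injective hmap
    rfl
  · rintro ⟨e, he⟩
    induction e with | _ a b
    have hb : b ∈ I.connectedComponentMk a := ConnectedComponent.sound he.symm.reachable
    exact ⟨⟨I.connectedComponentMk a, ⟨s(⟨a, rfl⟩, ⟨b, hb⟩), he⟩⟩, rfl⟩

lemma natCard_edgeSet_eq_sum_of_isAcyclic [Fintype I.ConnectedComponent] (hI : I.IsAcyclic) :
    Nat.card I.edgeSet = ∑ C : I.ConnectedComponent, (Nat.card C - 1) := by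
  rw [← sum_natCard_edgeSet_connectedComponent]
  refine sum_congr rfl fun C _ => ?_
  have := (isTree_iff_connected_and_card.1 (hI.isTree_connectedComponent C)).2
  omega

variable [Finite V] {H : SimpleGraph V}

lemma natCard_copy_le_prod [Fintype I.ConnectedComponent] :
    Nat.card (Copy I H) ≤ ∏ C : I.ConnectedComponent, Nat.card (Copy C.toSimpleGraph H) := by
  rw [← Nat.card_pi]
  refine Nat.card_le_card_of_injective
    (fun f C => f.comp (Copy.induce I C.supp)) fun f f' h => Copy.ext fun a => ?_
  exact DFunLike.congr_fun (congrFun h (I.connectedComponentMk a)) ⟨a, rfl⟩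

variable {n : ℕ} {p : unitInterval} {c : ℝ}

lemma copyFactor_nonneg (hc : Real.exp 1 * c < 1) : 0 ≤ copyFactor c :=
  div_nonneg (by positivity) (sub_pos.2 hc).le

lemma natCard_copy_le (hn : Nat.card V ≤ n) (hp : ∀ I : H.Subgraph, 1 / 2 ≤ expCopies n I.coe p)
    (hnp : (n : ℝ) * p ≤ c) (hc : Real.exp 1 * c < 1) (I : SimpleGraph A) :
    (Nat.card (Copy I H) : ℝ) ≤
      (n : ℝ) ^ Nat.card A * (copyFactor c * (p : ℝ)) ^ Nat.card I.edgeSet := by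
  classical
  have : Fintype I.ConnectedComponent := Fintype.ofFinite _
  have hp₀ : (0 : ℝ) ≤ p := p.2.1
  have hC : 0 ≤ copyFactor c := copyFactor_nonneg hc
  rcases isEmpty_or_nonempty (Copy I H) with _ | ⟨⟨f⟩⟩
  · rw [Nat.card_of_isEmpty, Nat.cast_zero]
    positivity
  have hI : I.IsAcyclic := (isAcyclic_of_half_le_expCopies hp (by
    nlinarith [Real.exp_one_gt_d9, mul_nonneg (Nat.cast_nonneg (α := ℝ) n) hp₀])).comap
      f.toHom f.injective
  calc (Nat.card (Copy I H) : ℝ)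
      ≤ ∏ C : I.ConnectedComponent, (Nat.card (Copy C.toSimpleGraph H) : ℝ) := by
        exact_mod_cast natCard_copy_le_prod (I := I) (H := H)
    _ ≤ ∏ C : I.ConnectedComponent,
          ((n : ℝ) ^ Nat.card C * (copyFactor c * (p : ℝ)) ^ (Nat.card C - 1)) := by
        refine prod_le_prod (fun _ _ => Nat.cast_nonneg _) fun C _ => ?_
        refine (natCard_copy_le_of_connected hn hp hnp hc C.connected_toSimpleGraph).trans_eq ?_
        have : Nonempty C := C.connected_toSimpleGraph.nonempty
        rw [← mul_pow_sub_one (Nat.card_pos (α := C)).ne' (n : ℝ)]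
        ring
    _ = (n : ℝ) ^ Nat.card A * (copyFactor c * (p : ℝ)) ^ Nat.card I.edgeSet := by
        rw [prod_mul_distrib, prod_pow_eq_pow_sum, prod_pow_eq_pow_sum,
          sum_natCard_connectedComponent, ← natCard_edgeSet_eq_sum_of_isAcyclic hI]

end Forests

section Embeddings

lemma pow_mul_factorial_le {n a : ℕ} (h : a ≤ n) :
    n ^ a * a.factorial ≤ a ^ a * n.descFactorial a := by
  rw [← Nat.descFactorial_self, Nat.descFactorial_eq_prod_range, Nat.descFactorial_eq_prod_range,
    ← card_range a, ← prod_const, ← prod_const, card_range, ← prod_mul_distrib,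
    ← prod_mul_distrib]
  refine prod_le_prod' fun i _ => ?_
  rw [Nat.mul_sub, Nat.mul_sub, mul_comm a n]
  exact Nat.sub_le_sub_left (Nat.mul_le_mul_right i h) _

lemma pow_le_exp_mul_descFactorial {n a : ℕ} (h : a ≤ n) :
    (n : ℝ) ^ a ≤ Real.exp a * n.descFactorial a := by
  refine le_of_mul_le_mul_right ?_ (Nat.cast_pos (α := ℝ).2 a.factorial_pos)
  calc (n : ℝ) ^ a * a.factorial ≤ (a : ℝ) ^ a * n.descFactorial a := by
        exact_mod_cast pow_mul_factorial_le h
    _ ≤ Real.exp a * a.factorial * n.descFactorial a := by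
        gcongr
        exact pow_le_exp_mul_factorial a
    _ = Real.exp a * n.descFactorial a * a.factorial := by ring

variable {U V : Type*} {J : SimpleGraph U} {H : SimpleGraph V}

lemma support_subset_range_of_le_map {φ : V ↪ U} (hφ : J ≤ H.map φ) : J.support ⊆ Set.range φ := by
  rintro i ⟨j, hij⟩
  obtain ⟨-, v, -, -, hv, -⟩ := hφ hij
  exact ⟨v, hv⟩

variable [Finite U] [Finite V]

lemma natCard_embedding_extending_le {S : Set U} {f : S → V} (hf : Function.Injective f) :
    Nat.card {φ : V ↪ U // ∀ s, φ (f s) = s} ≤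
      (Nat.card U - Nat.card S).descFactorial (Nat.card V - Nat.card S) := by
  classical
  cases nonempty_fintype U
  cases nonempty_fintype V
  have hcard : Nat.card (((Set.range f)ᶜ : Set V) ↪ (Sᶜ : Set U)) =
      (Nat.card U - Nat.card S).descFactorial (Nat.card V - Nat.card S) := by
    rw [Nat.card_eq_fintype_card, Fintype.card_embedding_eq, Fintype.card_compl_set,
      Fintype.card_compl_set, ← Fintype.card_congr (Equiv.ofInjective f hf)]
    simp only [Nat.card_eq_fintype_card]
  have hmaps : ∀ φ : {φ : V ↪ U // ∀ s, φ (f s) = s}, ∀ v ∈ (Set.range f)ᶜ, φ.1 v ∈ Sᶜ :=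
    fun φ v hv hvS => hv ⟨⟨φ.1 v, hvS⟩, φ.1.injective (φ.2 _)⟩
  rw [← hcard]
  refine Nat.card_le_card_of_injective (fun φ => ⟨fun v => ⟨φ.1 v, hmaps φ v v.2⟩,
    fun v w h => Subtype.ext (φ.1.injective (congrArg Subtype.val h))⟩) ?_
  intro φ ψ h
  refine Subtype.ext (DFunLike.ext _ _ fun v => ?_)
  by_cases hv : v ∈ Set.range f
  · obtain ⟨s, rfl⟩ := hv
    rw [φ.2, ψ.2]
  · exact congrArg Subtype.val (DFunLike.congr_fun h ⟨v, hv⟩)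

/-- An embedding of `V` under which the image of `H` contains `J` consists of a copy of `J` in `H`
and an embedding of the remaining vertices. -/
lemma natCard_embedding_le (J : SimpleGraph U) (H : SimpleGraph V) :
    Nat.card {φ : V ↪ U // J ≤ H.map φ} ≤ Nat.card (Copy (J.induce J.support) H) *
      (Nat.card U - Nat.card J.support).descFactorial (Nat.card V - Nat.card J.support) := by
  have hpre : ∀ φ : {φ : V ↪ U // J ≤ H.map φ}, ∀ i : J.support, ∃ v, φ.1 v = i := fun φ i =>
    support_subset_range_of_le_map φ.2 i.2
  choose g hg using hpre
  have hadj : ∀ φ i j, (J.induce J.support).Adj i j → H.Adj (g φ i) (g φ j) := fun φ i j h => by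
    rw [← map_adj_apply (f := φ.1), hg, hg]
    exact φ.2 h
  have hinj : ∀ φ, Function.Injective (g φ) := fun φ i j h =>
    Subtype.ext (by rw [← hg φ i, ← hg φ j, h])
  let c : {φ : V ↪ U // J ≤ H.map φ} → Copy (J.induce J.support) H := fun φ =>
    ⟨⟨g φ, hadj φ _ _⟩, hinj φ⟩
  calc Nat.card {φ : V ↪ U // J ≤ H.map φ}
      ≤ Nat.card (Σ f : Copy (J.induce J.support) H, {φ : V ↪ U // ∀ i, φ (f i) = i}) := by
        refine Nat.card_le_card_of_injective (fun φ => ⟨c φ, φ.1, hg φ⟩) fun φ ψ h => ?_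
        exact Subtype.ext (congrArg (fun x => x.2.1) h)
    _ ≤ _ := by
        cases nonempty_fintype (Copy (J.induce J.support) H)
        rw [Nat.card_sigma, Nat.card_eq_fintype_card, ← smul_eq_mul, ← card_univ]
        exact sum_le_card_nsmul _ _ _ fun f _ => natCard_embedding_extending_le f.injective

lemma natCard_support_le (J : SimpleGraph U) : Nat.card J.support ≤ 2 * Nat.card J.edgeSet := by
  classical
  cases nonempty_fintype U
  rw [Nat.card_eq_fintype_card, Nat.card_eq_fintype_card, card_edgeSet,
    ← sum_degrees_support_eq_twice_card_edges, ← Set.toFinset_card, card_eq_sum_ones]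
  exact sum_le_sum fun v hv => (J.degree_pos_iff_mem_support v).2 (Set.mem_toFinset.1 hv)

lemma pow_natCard_support_le (J : SimpleGraph U) {n : ℕ} (h : Nat.card J.support ≤ n) :
    (n : ℝ) ^ Nat.card J.support ≤
      (Real.exp 1 ^ 2) ^ Nat.card J.edgeSet * n.descFactorial (Nat.card J.support) := by
  refine (pow_le_exp_mul_descFactorial h).trans ?_
  rw [← Real.exp_one_pow, ← pow_mul]
  gcongr
  · exact Real.one_le_exp zero_le_one
  · exact natCard_support_le J

variable {n : ℕ} {p : unitInterval} {c : ℝ}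

lemma natCard_embedding_le_mul_pow (hn : Nat.card V ≤ n)
    (hp : ∀ I : H.Subgraph, 1 / 2 ≤ expCopies n I.coe p)
    (hnp : (n : ℝ) * p ≤ c) (hc : Real.exp 1 * c < 1) (J : SimpleGraph (Fin n)) :
    (Nat.card {φ : V ↪ Fin n // J ≤ H.map φ} : ℝ) ≤
      Nat.card (V ↪ Fin n) * (Real.exp 1 ^ 2 * copyFactor c * p) ^ Nat.card J.edgeSet := by
  classical
  cases nonempty_fintype V
  have hp₀ : (0 : ℝ) ≤ p := p.2.1
  have hC : 0 ≤ copyFactor c := copyFactor_nonneg hc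
  rcases isEmpty_or_nonempty {φ : V ↪ Fin n // J ≤ H.map φ} with _ | ⟨⟨φ, hφ⟩⟩
  · rw [Nat.card_of_isEmpty, Nat.cast_zero]
    positivity
  have hle := natCard_embedding_le J H
  have hcopy := natCard_copy_le hn hp hnp hc (J.induce J.support)
  have hedges : Nat.card (J.induce J.support).edgeSet = Nat.card J.edgeSet := by
    rw [Nat.card_eq_fintype_card, Nat.card_eq_fintype_card, card_edgeSet, card_edgeSet,
      card_edgeFinset_induce_support]
  rw [hedges] at hcopy
  rw [Nat.card_fin] at hle
  set a := Nat.card J.support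
  set e := Nat.card J.edgeSet
  have haV : a ≤ Nat.card V := by
    rw [Nat.card_congr (Equiv.ofInjective φ φ.injective)]
    exact Nat.card_mono (Set.toFinite _) (support_subset_range_of_le_map hφ)
  calc (Nat.card {φ : V ↪ Fin n // J ≤ H.map φ} : ℝ)
      ≤ Nat.card (Copy (J.induce J.support) H) * (n - a).descFactorial (Nat.card V - a) := by
        exact_mod_cast hle
    _ ≤ (Real.exp 1 ^ 2) ^ e * n.descFactorial a * (copyFactor c * p) ^ e *
          (n - a).descFactorial (Nat.card V - a) := by
        gcongr
        exact hcopy.trans (mul_le_mul_of_nonneg_right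
          (pow_natCard_support_le J (haV.trans hn)) (by positivity))
    _ = ((n - a).descFactorial (Nat.card V - a) * n.descFactorial a : ℕ) *
          (Real.exp 1 ^ 2 * copyFactor c * p) ^ e := by
        push_cast
        rw [mul_assoc (Real.exp 1 ^ 2), mul_pow (Real.exp 1 ^ 2)]
        ring
    _ = Nat.card (V ↪ Fin n) * (Real.exp 1 ^ 2 * copyFactor c * p) ^ e := by
        rw [Nat.descFactorial_mul_descFactorial haV, Nat.card_eq_fintype_card (α := V ↪ Fin n),
          Fintype.card_embedding_eq, Fintype.card_fin, Nat.card_eq_fintype_card]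

end Embeddings

open Classical in
lemma isSpread_embedding {V : Type*} [Fintype V] {H : SimpleGraph V} {n : ℕ} {p : unitInterval}
    {c : ℝ} (hn : Fintype.card V ≤ n) (hp : ∀ I : H.Subgraph, 1 / 2 ≤ expCopies n I.coe p)
    (hnp : (n : ℝ) * p ≤ c) (hc : Real.exp 1 * c < 1) :
    IsSpread univ (fun φ : V ↪ Fin n => (H.map φ).edgeFinset) (Fintype.card (V ↪ Fin n))
      (Real.exp 1 ^ 2 * copyFactor c * p) := by
  intro R _
  have hp₀ : (0 : ℝ) ≤ p := p.2.1
  have hC : 0 ≤ copyFactor c := copyFactor_nonneg hc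
  rcases ({φ : V ↪ Fin n | R ⊆ (H.map φ).edgeFinset} : Finset _).eq_empty_or_nonempty with
    h | ⟨φ, hφ⟩
  · rw [h, card_empty, Nat.cast_zero]
    positivity
  have hR : (fromEdgeSet (R : Set (Sym2 (Fin n)))).edgeSet = R := by
    rw [edgeSet_fromEdgeSet, sdiff_eq_left, Set.disjoint_left]
    exact fun e he => not_isDiag_of_mem_edgeFinset ((mem_filter.1 hφ).2 he)
  have hiff : ∀ ψ : V ↪ Fin n,
      fromEdgeSet (R : Set (Sym2 (Fin n))) ≤ H.map ψ ↔ R ⊆ (H.map ψ).edgeFinset := fun ψ => by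
    rw [← edgeSet_subset_edgeSet, hR, ← coe_edgeFinset, coe_subset]
  have hle := natCard_embedding_le_mul_pow (Nat.card_eq_fintype_card.trans_le hn) hp hnp hc
    (fromEdgeSet (R : Set (Sym2 (Fin n))))
  simpa only [hR, hiff, Nat.card_eq_fintype_card, Fintype.card_subtype, filter_univ_mem,
    mem_coe] using hle

section Threshold

variable {n : ℕ} {V : Type*} [Fintype V] {H : SimpleGraph V}

lemma pc_le_one (hn : Fintype.card V ≤ n) (hH : H ≠ ⊥) : pc n H ≤ 1 := by
  obtain ⟨p, hp, -⟩ := existsUnique_containProb_eq_half n H hn hH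
  exact (pc_spec n H hn hH p).1 hp ▸ p.2.2

lemma pc_lt_of_half_lt (hn : Fintype.card V ≤ n) (hH : H ≠ ⊥) {r : unitInterval}
    (hr : 1 / 2 < containProb n H r) : pc n H < r := by
  obtain ⟨p, hp, -⟩ := existsUnique_containProb_eq_half n H hn hH
  rw [← (pc_spec n H hn hH p).1 hp]
  exact (monotone_containProb n H).reflect_lt (hp ▸ hr)

open Classical in
lemma containProb_add_missProb (n : ℕ) (H : SimpleGraph V) (p : unitInterval) :
    containProb n H p + missProb (⊤ : SimpleGraph (Fin n)).edgeFinset p univ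
      (fun φ : V ↪ Fin n => (H.map φ).edgeFinset) = 1 := by
  have hiff : ∀ S : Finset (Sym2 (Fin n)), H.IsContained (fromEdgeSet (S : Set (Sym2 (Fin n)))) ↔
      ∃ φ ∈ (univ : Finset (V ↪ Fin n)), (H.map φ).edgeFinset ⊆ S := fun S => by
    simp only [IsContained, (copyEquivEmbedding H _).nonempty_congr, nonempty_subtype,
      le_fromEdgeSet_iff, mem_univ, true_and, ← coe_subset, coe_edgeFinset]
  have hcontain : containProb n H p = bernoulliExpect (⊤ : SimpleGraph (Fin n)).edgeFinset p
      fun S => if ∃ φ ∈ (univ : Finset (V ↪ Fin n)), (H.map φ).edgeFinset ⊆ S then 1 else 0 := by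
    simp only [containProb_eq', hiff]
    rfl
  rw [hcontain, missProb, ← bernoulliExpect_add]
  refine Eq.trans ?_ (bernoulliExpect_const (⊤ : SimpleGraph (Fin n)).edgeFinset p 1)
  congr with S
  split_ifs <;> norm_num

lemma natCard_edgeSet_lt_two_pow (H : SimpleGraph V) :
    Nat.card H.edgeSet < 2 ^ (2 * (Nat.log 2 (Fintype.card V) + 1)) := by
  classical
  calc Nat.card H.edgeSet ≤ (Fintype.card V).choose 2 := by
        rw [Nat.card_eq_fintype_card, ← edgeFinset_card]
        exact card_edgeFinset_le_card_choose_two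
    _ ≤ Fintype.card V ^ 2 := Nat.choose_le_pow _ _
    _ < (2 ^ (Nat.log 2 (Fintype.card V) + 1)) ^ 2 :=
        Nat.pow_lt_pow_left (Nat.lt_pow_succ_log_self one_lt_two _) two_ne_zero
    _ = 2 ^ (2 * (Nat.log 2 (Fintype.card V) + 1)) := by rw [← pow_mul, mul_comm]

lemma two_mul_natLog_add_one_le_logb {v : ℕ} (hv : 2 ≤ v) :
    2 * ((Nat.log 2 v : ℝ) + 1) ≤ 4 * Real.logb 2 v := by
  have hfloor : (Nat.log 2 v : ℝ) ≤ Real.logb 2 v := mod_cast Real.natLog_le_logb v 2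
  have hone : 1 ≤ Real.logb 2 v := by
    rw [Real.le_logb_iff_rpow_le one_lt_two (by positivity), Real.rpow_one]
    exact_mod_cast hv
  linarith

open Classical in
lemma two_thirds_le_containProb (hn : Fintype.card V ≤ n) {κ : ℝ} (hκ₀ : 0 ≤ κ)
    (hκ₁ : 64 * κ ≤ 1)
    (h : IsSpread univ (fun φ : V ↪ Fin n => (H.map φ).edgeFinset) (Fintype.card (V ↪ Fin n)) κ)
    {k : ℕ} (hk : Nat.card H.edgeSet < 2 ^ k) {r : unitInterval}
    (hr : (r : ℝ) = 1 - (1 - 64 * κ) ^ k) : 2 / 3 ≤ containProb n H r := by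
  have : Nonempty (V ↪ Fin n) :=
    Function.Embedding.nonempty_of_card_le (hn.trans_eq (Fintype.card_fin n).symm)
  have hN : (0 : ℝ) < Fintype.card (V ↪ Fin n) := Nat.cast_pos.2 Fintype.card_pos
  have hsize : ∀ φ ∈ (univ : Finset (V ↪ Fin n)), #(H.map φ).edgeFinset ≤ Nat.card H.edgeSet :=
    fun φ _ => by rw [card_edgeFinset_map, Nat.card_eq_fintype_card, ← edgeFinset_card]
  have hmiss := card_mul_missProb_le (A := fun φ : V ↪ Fin n => (H.map φ).edgeFinset)
    hκ₀ hκ₁ hN.le hk (fun φ _ => edgeFinset_mono le_top) hsize h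
  rw [card_univ, ← hr] at hmiss
  have hmiss' := le_of_mul_le_mul_left hmiss hN
  have hpos : (0 : ℝ) ≤ (1 / 4) ^ Nat.card H.edgeSet := by positivity
  linarith [containProb_add_missProb n H r]

open Classical in
lemma pc_lt_mul_logb_of_isSpread (hn : Fintype.card V ≤ n) (hH : H ≠ ⊥) {κ : ℝ} (hκ : 0 ≤ κ)
    (h : IsSpread univ (fun φ : V ↪ Fin n => (H.map φ).edgeFinset)
      (Fintype.card (V ↪ Fin n)) κ) :
    pc n H < 256 * κ * Real.logb 2 (Fintype.card V) := by
  obtain ⟨a, b, hab⟩ := ne_bot_iff_exists_adj.1 hH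
  have hlog := two_mul_natLog_add_one_le_logb (Fintype.one_lt_card_iff.2 ⟨a, b, hab.ne⟩)
  rcases lt_or_ge 1 (64 * κ) with hκ₁ | hκ₁
  · have := pc_le_one hn hH
    nlinarith [Nat.cast_nonneg (α := ℝ) (Nat.log 2 (Fintype.card V))]
  set k := 2 * (Nat.log 2 (Fintype.card V) + 1)
  have hpow₀ : 0 ≤ (1 - 64 * κ) ^ k := pow_nonneg (by linarith) k
  have hpow₁ : (1 - 64 * κ) ^ k ≤ 1 := pow_le_one₀ (by linarith) (by linarith)
  let r : unitInterval := ⟨1 - (1 - 64 * κ) ^ k, by linarith, by linarith⟩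
  have hhalf : 1 / 2 < containProb n H r :=
    lt_of_lt_of_le (by norm_num)
      (two_thirds_le_containProb hn hκ hκ₁ h (natCard_edgeSet_lt_two_pow H) rfl)
  calc pc n H < r := pc_lt_of_half_lt hn hH hhalf
    _ ≤ k * (64 * κ) := by
        have := one_add_mul_le_pow (a := -(64 * κ)) (by linarith) k
        rw [← sub_eq_add_neg] at this
        simp only [r]
        linarith
    _ ≤ 4 * Real.logb 2 (Fintype.card V) * (64 * κ) := by
        gcongr
        exact_mod_cast hlog
    _ = 256 * κ * Real.logb 2 (Fintype.card V) := by ring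

end Threshold

end KahnKalai

theorem theorem1p3_general {c : ℝ} (hc : c < Real.exp (-1)) :
    ∃ K : ℝ, ∀ (n : ℕ) (V : Type*) [Fintype V] (H : SimpleGraph V),
      Fintype.card V ≤ n → H ≠ ⊥ →
      KahnKalai.pE n H ≤ c / n →
      KahnKalai.pc n H < K * KahnKalai.pE n H * Real.logb 2 (Fintype.card V) := by
  have hec : Real.exp 1 * c < 1 := by
    rwa [Real.exp_neg, ← one_div, lt_div_iff₀' (Real.exp_pos 1)] at hc
  refine ⟨256 * (Real.exp 1 ^ 2 * KahnKalai.copyFactor c), fun n V _ H hn hH hpE => ?_⟩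
  obtain ⟨p, hpeq, hp⟩ := (KahnKalai.isLeast_pE n H hn).1
  rw [← hpeq] at hpE ⊢
  have hn₀ : (0 : ℝ) < n := by
    obtain ⟨a, -⟩ := SimpleGraph.ne_bot_iff_exists_adj.1 hH
    exact Nat.cast_pos.2 ((Fintype.card_pos_iff.2 ⟨a⟩).trans_le hn)
  have hspread := KahnKalai.isSpread_embedding hn hp ((le_div_iff₀' hn₀).1 hpE) hec
  have hκ : 0 ≤ Real.exp 1 ^ 2 * KahnKalai.copyFactor c * (p : ℝ) :=
    mul_nonneg (mul_nonneg (by positivity) (KahnKalai.copyFactor_nonneg hec)) p.2.1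
  simpa only [mul_assoc] using KahnKalai.pc_lt_mul_logb_of_isSpread hn hH hκ hspread

theorem theorem1p3 :
    ∃ K : ℝ, ∀ (n : ℕ) (V : Type*) [Fintype V] (H : SimpleGraph V),
      Fintype.card V ≤ n → H ≠ ⊥ →
      KahnKalai.pE n H < 1 / (3 * (n : ℝ)) →
      KahnKalai.pc n H < K * KahnKalai.pE n H * Real.logb 2 (Fintype.card V) := by
  obtain ⟨K, hK⟩ := theorem1p3_general (c := 1 / 3) (by linarith [Real.exp_neg_one_gt_d9])
  exact ⟨K, fun n V _ H hn hH h => hK n V H hn hH (by rw [div_div]; exact h.le)⟩
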